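/- Let $K$ be a knot and let $\mathbb{F}$ be a field of characteristic different from $2$. Choose an oriented diagram $D$ of $K$ with a base point. Let $C_{\mathrm{Lee}}(D;\mathbb{F}[T])$ be the Khovanov-type cube complex of the Frobenius system over $\mathbb{F}[T]$ with $A=\mathbb{F}[X,T]/(X^2-T)\cong\mathbb{F}[X]$, $\varepsilon(1)=0$, $\varepsilon(X)=1$, $\Delta(1)=1\otimes X+X\otimes 1$, $\Delta(X)=X\otimes X+T\otimes 1$. The base point makes it, and its homology $H_{\mathrm{Lee}}$, a module over $\mathbb{F}[X]$. The $X$-torsion order $\mathfrak{xo}_{\mathbb{F}}(K)$ is the minimal $n\ge 0$ such that $X^n$ annihilates $\{a\in H_{\mathrm{Lee}} : X^m a=0 \text{ for some } m\}$. Let $C_{\mathrm{BN}}(D;\mathbb{F}[H])$ be the cube complex of the Frobenius system over $\mathbb{F}[H]$ with $B=\mathbb{F}[X,H]/(X^2-XH)$, $\varepsilon(1)=0$, $\varepsilon(X)=1$, $\Delta(1)=1\otimes X+X\otimes 1-H\otimes 1$, $\Delta(X)=X\otimes X$, and let $\widetilde{C}_{\mathrm{BN}}=X\cdot C_{\mathrm{BN}}(D;\mathbb{F}[H])$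 be its reduced complex, where $X$ acts at the base point. Setting $H=1$ gives a complex over $\mathbb{F}$, which is filtered by the $q$-degree ($\deg 1=0$, $\deg X=\deg H=-2$, with the usual shifts); taking half of the shifted $q$-degree (which is even) as filtration degree, one obtains the reduced Bar-Natan–Lee–Turner spectral sequence of $K$ with coefficients in $\mathbb{F}$, whose $E_1$-page is the reduced Khovanov homology. Its number of pages $k$ is the minimal $k\ge 1$ with $E_k=E_\infty$. Then both minima exist, and $$\mathfrak{xo}_{\mathbb{F}}(K)=k-1 .$$ -/

import Mathlib

noncomputable section

/-! ### Knot diagrams as planar signed Gauss codes -/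

/-- A signed Gauss code. Starting from a base point one travels once along an oriented knot diagram
with `n` crossings and meets `2 * n` passages, numbered `0, …, 2 * n - 1` in order; every crossing is
met exactly twice, once on its over-strand and once on its under-strand, and has a sign. -/
structure GaussCode where
  /-- the number of crossings -/
  n : ℕ
  /-- the position at which the over-strand of a crossing is travelled -/
  overPos : Fin n → Fin (2 * n)
  /-- the position at which the under-strand of a crossing is travelled -/
  underPos : Fin n → Fin (2 * n)
  /-- every passage is the over- or the under-passage of exactly one crossing -/
  passages : Function.Bijective (Sum.elim overPos underPos)
  /-- `true` for a positive crossing, `false` for a negative crossing -/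
  positive : Fin n → Bool

namespace GaussCode

variable (D : GaussCode)

/-- The base point and the passages cut the diagram into `2 * n + 1` edges, numbered in the order of
travel: edge `i` ends at passage `i`, where edge `i + 1` starts; edge `0` starts at the base point and
edge `2 * n` ends there. (For `n = 0` the only edge starts and ends at the base point.) -/
abbrev Edge : Type := Fin (2 * D.n + 1)

/-- the edge that arrives at the crossing on the over-strand -/
def overIn (c : Fin D.n) : D.Edge := (D.overPos c).castSucc
/-- the edge that leaves the crossing on the over-strand -/
def overOut (c : Fin D.n) : D.Edge := (D.overPos c).succ
/-- the edge that arrives at the crossing on the under-strand -/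
def underIn (c : Fin D.n) : D.Edge := (D.underPos c).castSucc
/-- the edge that leaves the crossing on the under-strand -/
def underOut (c : Fin D.n) : D.Edge := (D.underPos c).succ

/-! Draw a crossing with both strands pointing upwards. One strand runs from the bottom left to the
top right: the over-strand at a positive crossing, the under-strand at a negative crossing. The other
one runs from the bottom right to the top left. -/

/-- the edge at the bottom left of a crossing -/
def bottomLeft (c : Fin D.n) : D.Edge := if D.positive c then D.overIn c else D.underIn c
/-- the edge at the top right of a crossing -/
def topRight (c : Fin D.n) : D.Edge := if D.positive c then D.overOut c else D.underOut c
/-- the edge at the bottom right of a crossing -/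
def bottomRight (c : Fin D.n) : D.Edge := if D.positive c then D.underIn c else D.overIn c
/-- the edge at the top left of a crossing -/
def topLeft (c : Fin D.n) : D.Edge := if D.positive c then D.underOut c else D.overOut c

/-- An edge has two sides: `(e, true)` is the left side of `e` and `(e, false)` is its right side, with
respect to the direction of travel. Two sides are adjacent if they are joined along the base point or
in one of the four corners (left, right, bottom, top) of a crossing. -/
inductive SideAdj : D.Edge × Bool → D.Edge × Bool → Prop
  | base (s : Bool) : SideAdj (Fin.last _, s) (0, s)
  | left (c : Fin D.n) : SideAdj (D.bottomLeft c, true) (D.topLeft c, true)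
  | right (c : Fin D.n) : SideAdj (D.bottomRight c, false) (D.topRight c, false)
  | bottom (c : Fin D.n) : SideAdj (D.bottomLeft c, false) (D.bottomRight c, true)
  | top (c : Fin D.n) : SideAdj (D.topLeft c, false) (D.topRight c, true)

/-- The faces of the closed oriented surface on which the code is drawn with complementary discs. -/
abbrev Face : Type := Quot D.SideAdj

end GaussCode

/-- A diagram of a knot, with an orientation and a base point, on the 2-sphere: a signed Gauss code
whose surface is a sphere. The diagram is a connected graph with `n + 1` vertices (the crossings and
the base point) and `2 * n + 1` edges, so that Euler's formula asks for `n + 2` faces. -/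
structure KnotDiagram extends GaussCode where
  planar : Nat.card toGaussCode.Face = n + 2

namespace GaussCode

variable (D : GaussCode)

/-! ### Resolutions and their circles -/

/-- A vertex of the cube of resolutions: `false` is the 0-smoothing, `true` is the 1-smoothing. -/
abbrev State : Type := Fin D.n → Bool

/-- Edges that are joined in the resolution `v`, at the base point or at a crossing. The 0-smoothing of
a positive crossing and the 1-smoothing of a negative crossing respect the orientation; the other
smoothings do not. -/
inductive Joined (v : D.State) : D.Edge → D.Edge → Prop
  | base : Joined v (Fin.last _) 0
  | oriented_under (c : Fin D.n) (h : v c ≠ D.positive c) : Joined v (D.underIn c) (D.overOut c)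
  | oriented_over (c : Fin D.n) (h : v c ≠ D.positive c) : Joined v (D.overIn c) (D.underOut c)
  | unoriented_in (c : Fin D.n) (h : v c = D.positive c) : Joined v (D.underIn c) (D.overIn c)
  | unoriented_out (c : Fin D.n) (h : v c = D.positive c) : Joined v (D.underOut c) (D.overOut c)

/-- The circles of the resolution `v`. -/
abbrev Circle (v : D.State) : Type := Quot (D.Joined v)

/-- The circle of the resolution `v` that contains the edge `e`. -/
def circle (v : D.State) (e : D.Edge) : D.Circle v := Quot.mk _ e

/-! ### The cube complex of a rank two Frobenius system

For `h t : R`, let `A = R[X] / (X ^ 2 - h X - t)` with `ε 1 = 0`, `ε X = 1`, and with the comultiplication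
that is the map of `A`-bimodules with `Δ 1 = 1 ⊗ X + X ⊗ 1 - h (1 ⊗ 1)`, hence `Δ X = X ⊗ X + t (1 ⊗ 1)`.
The Lee system is `R = 𝔽[T]`, `h = 0`, `t = T`; the Bar-Natan system is `R = 𝔽[H]`, `h = H`, `t = 0`. -/

variable (R : Type*) [CommRing R]

/-- Polynomials with one variable for every edge. -/
abbrev EdgeRing : Type _ := MvPolynomial D.Edge R

variable {R} (h t : R)

/-- The ideal of all relations in the resolution `v`: variables of edges on the same circle agree, and
each variable satisfies the defining equation of `A`. -/
def stateIdeal (v : D.State) : Ideal (D.EdgeRing R) :=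
  Ideal.span ({p | ∃ e f, D.Joined v e f ∧ p = MvPolynomial.X e - MvPolynomial.X f} ∪
    {p | ∃ e, p = MvPolynomial.X e ^ 2 - MvPolynomial.C h * MvPolynomial.X e - MvPolynomial.C t})

/-- The tensor product over `R` of one copy of `A` for every circle of the resolution `v`, presented as
the quotient of the edge ring in which the variable of an edge `e` is the element `X` of the tensor
factor of the circle through `e`. -/
def StateModule (v : D.State) : Type _ := D.EdgeRing R ⧸ D.stateIdeal h t v

instance (v : D.State) : AddCommGroup (D.StateModule h t v) :=
  inferInstanceAs (AddCommGroup (D.EdgeRing R ⧸ D.stateIdeal h t v))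

instance (v : D.State) : Module (D.EdgeRing R) (D.StateModule h t v) :=
  inferInstanceAs (Module (D.EdgeRing R) (D.EdgeRing R ⧸ D.stateIdeal h t v))

instance (v : D.State) : Module R (D.StateModule h t v) :=
  inferInstanceAs (Module R (D.EdgeRing R ⧸ D.stateIdeal h t v))

instance (v : D.State) : IsScalarTower R (D.EdgeRing R) (D.StateModule h t v) :=
  inferInstanceAs (IsScalarTower R (D.EdgeRing R) (D.EdgeRing R ⧸ D.stateIdeal h t v))

/-- The class of a polynomial in the module of the resolution `v`. -/
def toStateModule (v : D.State) : D.EdgeRing R →ₗ[D.EdgeRing R] D.StateModule h t v :=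
  (D.stateIdeal h t v).mkQ

/-- The two strands of a smoothing of the crossing `c` contain the edges `underIn c` and `underOut c`,
respectively. If `v` arises from another resolution by changing the 0-smoothing of `c` to the
1-smoothing, then either two circles merge, so that both strands lie on one circle of `v`, and the
map is the multiplication of `A`, that is, it sends the class of a polynomial to the class of the same
polynomial; or one circle splits into two circles of `v`, and the map is the comultiplication of `A`,
that is, it sends the class of `p` to the class of `p * (x + y - h)` with `x`, `y` the variables of the
two new circles. -/
def edgeFactor (v : D.State) (c : Fin D.n) : D.EdgeRing R :=
  open Classical in
  if D.circle v (D.underIn c) = D.circle v (D.underOut c) then 1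
  else MvPolynomial.X (D.underIn c) + MvPolynomial.X (D.underOut c) - MvPolynomial.C h

theorem sub_mem_stateIdeal {v : D.State} {e f : D.Edge} (hef : D.circle v e = D.circle v f) :
    (MvPolynomial.X e - MvPolynomial.X f : D.EdgeRing R) ∈ D.stateIdeal h t v := by
  have key : Relation.EqvGen (D.Joined v) e f := Quot.eqvGen_exact hef
  induction key with
  | rel x y hxy => exact Ideal.subset_span (Or.inl ⟨x, y, hxy, rfl⟩)
  | refl x => simp
  | symm x y _ ih => simpa using neg_mem (ih (Quot.eqvGen_sound ‹_›))
  | trans x y z _ _ ih₁ ih₂ =>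
    simpa using add_mem (ih₁ (Quot.eqvGen_sound ‹_›)) (ih₂ (Quot.eqvGen_sound ‹_›))

theorem sub_mul_edgeFactor_mem (v : D.State) (c : Fin D.n) :
    (MvPolynomial.X (D.underIn c) - MvPolynomial.X (D.underOut c)) * D.edgeFactor h v c
      ∈ D.stateIdeal h t v := by
  unfold edgeFactor
  split_ifs with hc
  · simpa using D.sub_mem_stateIdeal h t hc
  · have h1 : ∀ e : D.Edge, (MvPolynomial.X e ^ 2 - MvPolynomial.C h * MvPolynomial.X e -
        MvPolynomial.C t : D.EdgeRing R) ∈ D.stateIdeal h t v :=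
      fun e => Ideal.subset_span (Or.inr ⟨e, rfl⟩)
    convert sub_mem (h1 (D.underIn c)) (h1 (D.underOut c)) using 1
    ring

theorem stateIdeal_le_comap (v w : D.State) (c : Fin D.n) (hw : ∀ c', c' ≠ c → w c' = v c') :
    D.stateIdeal h t w ≤ Submodule.comap
      (LinearMap.mulRight (D.EdgeRing R) (D.edgeFactor h v c)) (D.stateIdeal h t v) := by
  have hj : ∀ {e f}, D.Joined v e f →
      (MvPolynomial.X e - MvPolynomial.X f : D.EdgeRing R) ∈ D.stateIdeal h t v :=
    fun hef => D.sub_mem_stateIdeal h t (Quot.sound hef)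
  have hjc : ∀ {e f}, D.Joined v e f →
      (MvPolynomial.X e - MvPolynomial.X f) * D.edgeFactor h v c ∈ D.stateIdeal h t v :=
    fun hef => Ideal.mul_mem_right _ _ (hj hef)
  have huo := D.sub_mul_edgeFactor_mem h t v c
  refine Ideal.span_le.2 ?_
  rintro p (⟨e, f, hef, rfl⟩ | ⟨e, rfl⟩)
  · change (MvPolynomial.X e - MvPolynomial.X f) * D.edgeFactor h v c ∈ D.stateIdeal h t v
    cases hef with
    | base => exact hjc .base
    | oriented_under c' hc' =>
      by_cases hv : v c' ≠ D.positive c'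
      · exact hjc (.oriented_under c' hv)
      · obtain rfl : c' = c := by
          by_contra hne
          exact hv (hw c' hne ▸ hc')
        convert add_mem huo (hjc (.unoriented_out c' (not_not.1 hv))) using 1
        ring
    | oriented_over c' hc' =>
      by_cases hv : v c' ≠ D.positive c'
      · exact hjc (.oriented_over c' hv)
      · obtain rfl : c' = c := by
          by_contra hne
          exact hv (hw c' hne ▸ hc')
        convert sub_mem huo (hjc (.unoriented_in c' (not_not.1 hv))) using 1
        ring
    | unoriented_in c' hc' =>
      by_cases hv : v c' = D.positive c'
      · exact hjc (.unoriented_in c' hv)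
      · obtain rfl : c' = c := by
          by_contra hne
          exact hv (hw c' hne ▸ hc')
        convert sub_mem huo (hjc (.oriented_over c' hv)) using 1
        ring
    | unoriented_out c' hc' =>
      by_cases hv : v c' = D.positive c'
      · exact hjc (.unoriented_out c' hv)
      · obtain rfl : c' = c := by
          by_contra hne
          exact hv (hw c' hne ▸ hc')
        convert sub_mem (hjc (.oriented_under c' hv)) huo using 1
        ring
  · exact Ideal.mul_mem_right (D.edgeFactor h v c) (D.stateIdeal h t v)
      (Ideal.subset_span (Or.inr ⟨e, rfl⟩))

/-- The map of the cube that changes the crossing `c` from the 0-smoothing to the 1-smoothing. Here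
`v` is the target, with `v c = true`. -/
def edgeMap (v : D.State) (c : Fin D.n) :
    D.StateModule h t (Function.update v c false) →ₗ[D.EdgeRing R] D.StateModule h t v :=
  Submodule.mapQ (D.stateIdeal h t (Function.update v c false)) (D.stateIdeal h t v)
    (LinearMap.mulRight (D.EdgeRing R) (D.edgeFactor h v c))
    (D.stateIdeal_le_comap h t v _ c fun _ hc => Function.update_of_ne hc _ _)

/-- The complex, as the direct sum of all its cochain modules: one summand for every resolution. The
resolution `v` lies in homological degree `#{c | v c = true}` minus the number of negative
crossings. -/
abbrev Chain : Type _ := (v : D.State) → D.StateModule h t v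

/-- The coboundary map, with the usual signs of a cube. -/
def d : D.Chain h t →ₗ[D.EdgeRing R] D.Chain h t :=
  LinearMap.pi fun v => ∑ c with v c = true,
    ((-1 : ℤ) ^ (Finset.univ.filter fun c' => c' < c ∧ v c' = true).card) •
      (D.edgeMap h t v c ∘ₗ LinearMap.proj (Function.update v c false))

/-- The homology of the complex, as the direct sum over all homological degrees. -/
abbrev Homology : Type _ :=
  LinearMap.ker (D.d h t) ⧸ (LinearMap.range (D.d h t)).submoduleOf (LinearMap.ker (D.d h t))

variable (R) in
/-- The variable that acts on the complex and on the homology as the element `X` of the tensor factor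
of the circle through the base point. -/
def baseX : D.EdgeRing R := MvPolynomial.X 0

/-- The reduced complex `X · C`. -/
def reduced : Submodule (D.EdgeRing R) (D.Chain h t) :=
  LinearMap.range (LinearMap.lsmul (D.EdgeRing R) (D.Chain h t) (D.baseX R))

/-! ### The quantum filtration -/

/-- The `q`-degree of a product of `k` variables of distinct circles in the resolution `v`: a circle with
label `1` counts `1`, a circle with label `X` counts `-1`, and the result is shifted by the number of
1-smoothings plus the number of positive crossings minus twice the number of negative crossings. -/
def qDegree (v : D.State) (k : ℕ) : ℤ :=
  (Nat.card (D.Circle v) : ℤ) - 2 * k + (Finset.univ.filter fun c => v c = true).card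
    + (Finset.univ.filter fun c => D.positive c = true).card
    - 2 * (Finset.univ.filter fun c => D.positive c = false).card

/-- The part of `q`-degree at least `j` of the module of the resolution `v`. It is meant for `h`, `t` of
degree zero, as for `h = 1`, `t = 0`. -/
def qFiltrationAt (v : D.State) (j : ℤ) : Submodule R (D.StateModule h t v) :=
  Submodule.span R {y | ∃ m : D.Edge →₀ ℕ, j ≤ D.qDegree v m.degree ∧
    y = D.toStateModule h t v (MvPolynomial.monomial m 1)}

/-- The descending filtration of the reduced complex by the `q`-degree. All generators of the reduced
complex of a knot have odd `q`-degree; the degree is raised by one, as usual for the reduced complex,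
and divided by two. -/
def reducedFiltration (p : ℤ) : Submodule R (D.Chain h t) :=
  (D.reduced h t).restrictScalars R ⊓
    Submodule.pi Set.univ fun v => D.qFiltrationAt h t v (2 * p - 1)

end GaussCode

/-! ### The spectral sequence of a filtered complex -/

namespace FilteredComplex

variable {k M : Type*} [CommRing k] [AddCommGroup M] [Module k M]
  (d : M →ₗ[k] M) (Fil : ℤ → Submodule k M)

/-- `Z_r^p = {x ∈ F^p | d x ∈ F^(p+r)}`, for a descending filtration `F`. -/
def cycles (r p : ℤ) : Submodule k M := Fil p ⊓ (Fil (p + r)).comap d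

/-- `B_r^p = Z_(r-1)^(p+1) + d Z_(r-1)^(p-r+1)`. -/
def boundaries (r p : ℤ) : Submodule k M :=
  cycles d Fil (r - 1) (p + 1) ⊔ (cycles d Fil (r - 1) (p - r + 1)).map d

/-- The differential `d_r` from `E_r^p = Z_r^p / B_r^p` to `E_r^(p+r) = Z_r^(p+r) / B_r^(p+r)`, which sends
the class of `x` to the class of `d x`; here it is written on representatives, and its target is
enlarged to the quotient of the whole module by `B_r^(p+r)`. -/
def pageDifferential (r p : ℤ) : cycles d Fil r p →ₗ[k] M ⧸ boundaries d Fil r (p + r) :=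
  (boundaries d Fil r (p + r)).mkQ ∘ₗ d ∘ₗ (cycles d Fil r p).subtype

/-- The pages, from the first one on, that agree with the limit page: all differentials on the page and
on the later pages vanish. -/
def stablePages : Set ℕ :=
  {s | 1 ≤ s ∧ ∀ r : ℕ, s ≤ r → ∀ p : ℤ, pageDifferential d Fil r p = 0}

end FilteredComplex

namespace KnotDiagram

variable (D : KnotDiagram) (F : Type*) [Field F]

/-- The homology of the Lee complex over `F[T]`. -/
abbrev LeeHomology : Type _ := D.Homology (R := Polynomial F) 0 Polynomial.X

/-- The exponents `n` such that `X ^ n` annihilates all `X`-power torsion of the Lee homology. -/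
def xTorsionExponents : Set ℕ :=
  {n | ∀ a : D.LeeHomology F,
    (∃ m : ℕ, D.baseX (Polynomial F) ^ m • a = 0) → D.baseX (Polynomial F) ^ n • a = 0}

/-- The `X`-torsion order. -/
def xTorsionOrder : ℕ := sInf (D.xTorsionExponents F)

/-- The stable pages of the reduced Bar-Natan-Lee-Turner spectral sequence, that is, the spectral
sequence of the reduced Bar-Natan complex over `F[H]` at `H = 1`, filtered by the `q`-degree. -/
def stableBNLTPages : Set ℕ :=
  FilteredComplex.stablePages ((D.d (1 : F) 0).restrictScalars F) (D.reducedFiltration (1 : F) 0)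

/-- The number of pages of the reduced Bar-Natan-Lee-Turner spectral sequence: the first page that
agrees with the limit page, where the reduced Khovanov homology is the first page. -/
def numPages : ℕ := sInf (D.stableBNLTPages F)

end KnotDiagram

end

/-!
The theorem holds because the Lee complex over `𝔽[X]` is, up to the unit `2`, the Rees complex of the
filtered reduced Bar-Natan complex at `H = 1`.

**The two systems.** Let `x₀` be the variable of the base point circle in the Lee system, so that
`T = x₀ ^ 2`. If `2` is invertible, put `y = x + x₀` for every circle and `H = 2 x₀`. Then
`x ^ 2 = T` becomes `y ^ 2 = H y`, the base point has `y₀ = H`, and the splitting factor `x + x'`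
becomes `y + y' - H`: these are the relations and factors of the reduced Bar-Natan complex over
`𝔽[H]`, in which the Lee variable `x₀` acts as `H / 2`. Setting `H = 1` while remembering the degree
identifies a homogeneous Lee chain of filtration degree `q` with an element of the step `q` of the
reduced complex over `𝔽`. This is `KnotDiagram.reesMap`; it is injective by the combinatorial
Nullstellensatz (`GaussCode.mem_stateIdeal_of_eval_eq_zero`), its values exhaust the filtration
(`KnotDiagram.exists_reesMap_eq_single`), and it is a chain map (`KnotDiagram.reesMap_d`).

**The common condition.** Both invariants express how far the differential is from being strict.
For a filtered complex over a field let `StrictUpTo n` say that every boundary in step `q` bounds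
a chain in step `q - n`. A homogeneous cycle is torsion exactly if it becomes a boundary after `H` is
set to `1`, and `X ^ n` kills its class exactly if it bounds a chain in step `q - n`; hence
`X ^ n` kills all torsion exactly if `StrictUpTo n` holds
(`FilteredComplex.torsion_annihilated_iff_strictUpTo`). On the other hand all differentials from page
`n + 1` on vanish exactly if `StrictUpTo n` holds
(`FilteredComplex.add_one_mem_stablePages_iff`). The filtration is bounded, so that some `n` exists.

**Planarity.** That the differentials square to zero and preserve the degree requires that a change of
smoothing always merges two circles or splits one (`KnotDiagram.circle_under_eq_iff_ne`), which
can fail for non-planar Gauss codes. On the sphere Euler's formula yields a checkerboard colouring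
(`KnotDiagram.exists_checkerboard`), hence the two passages of a crossing have positions of opposite
parity. After reversing the edges with odd numbers every smoothing joins incoming to outgoing edges, so
that the circles are the cycles of a permutation, and changing a smoothing multiplies the
permutation by a transposition.
-/

/-! ### Strict filtrations, stable pages and torsion in the Rees complex -/

namespace FilteredComplex

/-- Every boundary of filtration degree `q` bounds a chain of filtration degree `q - n`: the
differential is strict up to a loss of `n` filtration steps. -/
def StrictUpTo {k M : Type*} [CommRing k] [AddCommGroup M] [Module k M] (d : M →ₗ[k] M)
    (Fil : ℤ → Submodule k M) (n : ℕ) : Prop :=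
  ∀ p q : ℤ, ∀ x ∈ Fil p, d x ∈ Fil q → ∃ w ∈ Fil (q - n), d w = d x

theorem pageDifferential_eq_zero_iff {k M : Type*} [CommRing k] [AddCommGroup M] [Module k M]
    (d : M →ₗ[k] M) (Fil : ℤ → Submodule k M) (r p : ℤ) :
    pageDifferential d Fil r p = 0 ↔
      ∀ x ∈ Fil p, d x ∈ Fil (p + r) → d x ∈ boundaries d Fil r (p + r) := by
  rw [LinearMap.ext_iff]
  constructor
  · intro H x hx hdx
    have := H ⟨x, hx, hdx⟩
    simpa [pageDifferential] using this
  · rintro H ⟨x, hx, hdx⟩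
    simpa [pageDifferential] using H x hx hdx

/-- The page `n + 1` is stable exactly if the differential is strict up to `n` steps. -/
theorem add_one_mem_stablePages_iff {k M : Type*} [CommRing k] [AddCommGroup M] [Module k M]
    {d : M →ₗ[k] M} {Fil : ℤ → Submodule k M} (hanti : Antitone Fil)
    {P : ℤ} (hbot : ∀ p, P ≤ p → Fil p = ⊥) (n : ℕ) :
    n + 1 ∈ stablePages d Fil ↔ StrictUpTo d Fil n := by
  constructor
  · rintro ⟨-, hs⟩
    -- A boundary that is `n + 1` or more steps deeper than its chain bounds a chain one step
    -- deeper: successively correct the chain, until its boundary lies in a zero filtration step.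
    have improve : ∀ (N : ℕ) (p q : ℤ) (x : M), x ∈ Fil p → d x ∈ Fil q → p + (n + 1) ≤ q →
        P ≤ q + N → ∃ w ∈ Fil (p + 1), d w = d x := by
      intro N
      induction N with
      | zero =>
        intro p q x hx hdx _ hq
        rw [hbot q (by simpa using hq), Submodule.mem_bot] at hdx
        exact ⟨0, zero_mem _, by rw [hdx, map_zero]⟩
      | succ N ih =>
        intro p q x hx hdx hpq hq
        obtain ⟨r, rfl⟩ : ∃ r : ℕ, q = p + r := ⟨(q - p).toNat, by omega⟩
        have h0 := (pageDifferential_eq_zero_iff d Fil r p).1 (hs r (by omega) p) x hx hdx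
        obtain ⟨z, hz, y, ⟨w, hw, rfl⟩, hzy⟩ := Submodule.mem_sup.1 h0
        have hw1 : w ∈ Fil (p + 1) := by
          have := hw.1
          rwa [show p + (r : ℤ) - r + 1 = p + 1 by ring] at this
        have hz1 : d (x - w) = z := by rw [map_sub, ← hzy]; simp
        obtain ⟨w', hw', hdw'⟩ := ih p (p + r + 1) (x - w)
          (sub_mem hx (hanti (by omega) hw1)) (hz1 ▸ hz.1) (by omega) (by push_cast at hq; omega)
        exact ⟨w' + w, add_mem hw' hw1, by rw [map_add, hdw', map_sub]; abel⟩
    have push : ∀ (N : ℕ) (p q : ℤ) (x : M), x ∈ Fil p → d x ∈ Fil q → q - n ≤ p + N →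
        ∃ w ∈ Fil (q - n), d w = d x := by
      intro N
      induction N with
      | zero => exact fun p q x hx _ hpq => ⟨x, hanti (by simpa using hpq) hx, rfl⟩
      | succ N ih =>
        intro p q x hx hdx hpq
        rcases le_or_gt (q - n) p with h | h
        · exact ⟨x, hanti h hx, rfl⟩
        · obtain ⟨w, hw, hdw⟩ := improve (P - q).toNat p q x hx hdx (by omega) (by omega)
          obtain ⟨w', hw', hdw'⟩ := ih (p + 1) q w hw (hdw ▸ hdx) (by push_cast at hpq; omega)
          exact ⟨w', hw', hdw'.trans hdw⟩
    exact fun p q x hx hdx => push (q - n - p).toNat p q x hx hdx (by omega)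
  · refine fun H => ⟨by omega, fun r hr p => (pageDifferential_eq_zero_iff d Fil r p).2 ?_⟩
    intro x hx hdx
    obtain ⟨w, hw, hdw⟩ := H p (p + r) x hx hdx
    have hdw' : d w ∈ Fil (p + r - r + 1 + (r - 1)) := hdw ▸ hanti (by omega) hdx
    exact Submodule.mem_sup_right ⟨w, ⟨hanti (by omega) hw, hdw'⟩, hdw⟩

theorem StrictUpTo.exists_of_bounded {k M : Type*} [CommRing k] [AddCommGroup M] [Module k M]
    {d : M →ₗ[k] M} {Fil : ℤ → Submodule k M} (hanti : Antitone Fil)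
    {P Q : ℤ} (hbot : ∀ p, P ≤ p → Fil p = ⊥) (htop : ∀ p, Fil p ≤ Fil Q) :
    ∃ n, StrictUpTo d Fil n := by
  refine ⟨(P - Q).toNat, fun p q x hx hdx => ?_⟩
  rcases le_or_gt P q with h | h
  · rw [hbot q h, Submodule.mem_bot] at hdx
    exact ⟨0, zero_mem _, by rw [hdx, map_zero]⟩
  · exact ⟨x, hanti (by omega) (htop p hx), rfl⟩

/-- Torsion in the homology of a Rees complex. The map `Φ` identifies `L` with the Rees module of the
filtration, that is, with the finitely supported families of elements of the steps of the filtration,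
so that `x` acts, up to the scalar `u`, as the inclusion of a step into the one before. -/
theorem torsion_annihilated_iff_strictUpTo {k M S L : Type*} [Field k] [AddCommGroup M] [Module k M]
    [CommRing S] [AddCommGroup L] [Module S L] {d : M →ₗ[k] M} {Fil : ℤ → Submodule k M}
    (dL : L →ₗ[S] L) (x : S) (Φ : L →+ (ℤ → M)) {u : k} (hu : u ≠ 0)
    (hanti : Antitone Fil) (hdd : ∀ y, d (d y) = 0) (hinj : ∀ a, Φ a = 0 → a = 0)
    (hmem : ∀ a q, Φ a q ∈ Fil q)
    (hfin : ∀ a, (Function.support (Φ a)).Finite)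
    (hsurj : ∀ q, ∀ c ∈ Fil q, ∃ a, Φ a = Pi.single q c)
    (hd : ∀ a q, Φ (dL a) q = d (Φ a q)) (hx : ∀ a q, Φ (x • a) q = u • Φ a (q + 1)) (n : ℕ) :
    (∀ a, dL a = 0 → (∃ m : ℕ, x ^ m • a ∈ LinearMap.range dL) →
      x ^ n • a ∈ LinearMap.range dL) ↔ StrictUpTo d Fil n := by
  have hpow : ∀ (m : ℕ) a q, Φ (x ^ m • a) q = u ^ m • Φ a (q + m) := by
    intro m
    induction m with
    | zero => simp
    | succ m ih =>
      intro a q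
      rw [pow_succ', mul_smul, hx, ih, smul_smul, pow_succ', add_assoc]
      push_cast
      rw [add_comm (1 : ℤ)]
  have hΦ : ∀ a b, Φ a = Φ b → a = b := fun a b h =>
    sub_eq_zero.1 (hinj _ (by rw [map_sub, h, sub_self]))
  constructor
  · intro H p q y hy hdy
    have hy' : y ∈ Fil (q - (q - p).toNat) := hanti (by omega) hy
    set m := (q - p).toNat
    obtain ⟨a, ha⟩ := hsurj q _ hdy
    obtain ⟨b, hb⟩ := hsurj _ _ (Submodule.smul_mem _ (u ^ m) hy')
    have hda : dL a = 0 := hinj _ <| funext fun q' => by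
      rw [hd, ha]
      rcases eq_or_ne q' q with rfl | hq
      · simp [hdd]
      · simp [Pi.single_eq_of_ne hq]
    have hab : x ^ m • a = dL b := hΦ _ _ <| funext fun q' => by
      rw [hpow, hd, ha, hb]
      rcases eq_or_ne q' (q - m) with rfl | hq
      · simp
      · rw [Pi.single_eq_of_ne hq, Pi.single_eq_of_ne (by omega)]
        simp
    obtain ⟨w, hw⟩ := H a hda ⟨m, b, hab.symm⟩
    refine ⟨(u ^ n)⁻¹ • Φ w (q - n), Submodule.smul_mem _ _ (hmem _ _), ?_⟩
    rw [map_smul, ← hd, hw, hpow, ha, show q - (n : ℤ) + n = q by ring, Pi.single_eq_same, smul_smul,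
      inv_mul_cancel₀ (pow_ne_zero _ hu), one_smul]
  · rintro H a hda ⟨m, b, hb⟩
    have h1 : ∀ q, ∃ w, Φ (dL w) = (Pi.single (q - n) (u ^ n • Φ a q) : ℤ → M) := by
      intro q
      have h2 : Φ a q = d ((u ^ m)⁻¹ • Φ b (q - m)) := by
        rw [map_smul, ← hd, hb, hpow, show q - (m : ℤ) + m = q by ring, smul_smul,
          inv_mul_cancel₀ (pow_ne_zero _ hu), one_smul]
      obtain ⟨w, hw, hdw⟩ := H (q - m) q _ (Submodule.smul_mem _ (u ^ m)⁻¹ (hmem b _))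
        (h2 ▸ hmem a q)
      obtain ⟨w', hw'⟩ := hsurj _ _ (Submodule.smul_mem _ (u ^ n) hw)
      refine ⟨w', funext fun q' => ?_⟩
      rw [hd, hw', h2, ← hdw]
      rcases eq_or_ne q' (q - n) with rfl | hq
      · simp
      · simp [Pi.single_eq_of_ne hq]
    choose w hw using h1
    refine ⟨∑ q ∈ (hfin a).toFinset, w q, hΦ _ _ <| funext fun q' => ?_⟩
    rw [map_sum, map_sum, Finset.sum_apply, hpow]
    simp only [hw]
    rw [Finset.sum_eq_single (q' + n)]
    · simp
    · intro q _ hq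
      exact Pi.single_eq_of_ne (by omega) _
    · intro hq
      have : Φ a (q' + n) = 0 := by simpa using hq
      simp [this]

end FilteredComplex

/-! ### Planarity and the checkerboard colouring -/

namespace GaussCode

variable (D : GaussCode)

/-- The bijection between the over- and under-passages of the crossings and the positions. -/
noncomputable def passageEquiv : Fin D.n ⊕ Fin D.n ≃ Fin (2 * D.n) :=
  Equiv.ofBijective _ D.passages

/-- The crossing that is met at a position. -/
noncomputable def crossing (j : Fin (2 * D.n)) : Fin D.n := (D.passageEquiv.symm j).elim id id

@[simp] theorem crossing_overPos (c : Fin D.n) : D.crossing (D.overPos c) = c := by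
  have : D.passageEquiv.symm (D.overPos c) = Sum.inl c := by
    rw [Equiv.symm_apply_eq]; rfl
  simp [crossing, this]

@[simp] theorem crossing_underPos (c : Fin D.n) : D.crossing (D.underPos c) = c := by
  have : D.passageEquiv.symm (D.underPos c) = Sum.inr c := by
    rw [Equiv.symm_apply_eq]; rfl
  simp [crossing, this]

theorem eq_overPos_or_eq_underPos (j : Fin (2 * D.n)) :
    ∃ c, j = D.overPos c ∨ j = D.underPos c := by
  obtain ⟨c | c, rfl⟩ := D.passages.2 j
  exacts [⟨c, Or.inl rfl⟩, ⟨c, Or.inr rfl⟩]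

theorem sum_position {M : Type*} [AddCommMonoid M] (y : Fin (2 * D.n) → M) :
    ∑ j, y j = ∑ c, (y (D.overPos c) + y (D.underPos c)) := by
  rw [← D.passageEquiv.sum_comp, Fintype.sum_sum_type, ← Finset.sum_add_distrib]
  rfl

/-- The vertex at which an edge starts; `none` is the base point. -/
noncomputable def startVertex : D.Edge → Option (Fin D.n) := Fin.cons none (some ∘ D.crossing)

/-- The vertex at which an edge ends; `none` is the base point. -/
noncomputable def endVertex : D.Edge → Option (Fin D.n) :=
  Fin.snoc (α := fun _ => Option (Fin D.n)) (some ∘ D.crossing) none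

/-- The coboundary, with coefficients in `ZMod 2`, from functions on the vertices of the diagram to
functions on its edges. -/
noncomputable def vertexCoboundary :
    (Option (Fin D.n) → ZMod 2) →ₗ[ZMod 2] (D.Edge → ZMod 2) :=
  LinearMap.funLeft _ _ D.startVertex + LinearMap.funLeft _ _ D.endVertex

/-- The boundary, with coefficients in `ZMod 2`, from the faces to the edges of the diagram. -/
def faceBoundary : (D.Face → ZMod 2) →ₗ[ZMod 2] (D.Edge → ZMod 2) :=
  LinearMap.funLeft _ _ (fun e => Quot.mk _ (e, true)) +
    LinearMap.funLeft _ _ (fun e => Quot.mk _ (e, false))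

theorem vertexCoboundary_dotProduct (h : Option (Fin D.n) → ZMod 2) (x : D.Edge → ZMod 2) :
    D.vertexCoboundary h ⬝ᵥ x = h none * (x 0 + x (Fin.last _)) +
      ∑ c, h (some c) * (x (D.overIn c) + x (D.overOut c) + x (D.underIn c) + x (D.underOut c)) := by
  have h1 : ∑ e, h (D.startVertex e) * x e = h none * x 0 +
      ∑ c, h (some c) * (x (D.overOut c) + x (D.underOut c)) := by
    rw [Fin.sum_univ_succ, D.sum_position]
    simp [startVertex, overOut, underOut, mul_add]
  have h2 : ∑ e, h (D.endVertex e) * x e = h none * x (Fin.last _) +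
      ∑ c, h (some c) * (x (D.overIn c) + x (D.underIn c)) := by
    rw [Fin.sum_univ_castSucc, D.sum_position, add_comm]
    simp [endVertex, overIn, underIn, mul_add]
  have h3 : D.vertexCoboundary h ⬝ᵥ x =
      ∑ e, h (D.startVertex e) * x e + ∑ e, h (D.endVertex e) * x e := by
    rw [← Finset.sum_add_distrib]
    exact Finset.sum_congr rfl fun e _ => add_mul _ _ _
  rw [h3, h1, h2, add_add_add_comm, ← mul_add, ← Finset.sum_add_distrib]
  congr 1
  exact Finset.sum_congr rfl fun c _ => by ring

theorem finrank_range_vertexCoboundary :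
    Module.finrank (ZMod 2) (LinearMap.range D.vertexCoboundary) = D.n := by
  have hker : LinearMap.ker D.vertexCoboundary ≤ Submodule.span (ZMod 2) {fun _ => 1} := by
    intro h hh
    have hst : ∀ e, h (D.startVertex e) = h (D.endVertex e) := fun e =>
      CharTwo.add_eq_zero.1 (congrFun (LinearMap.mem_ker.1 hh) e)
    have hall : ∀ e, h (D.startVertex e) = h none := by
      intro e
      induction e using Fin.induction with
      | zero => simp [startVertex]
      | succ j ih =>
        rw [hst] at ih
        simpa [startVertex, endVertex] using ih
    refine Submodule.mem_span_singleton.2 ⟨h none, funext fun v => ?_⟩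
    cases v with
    | none => simp
    | some c => simpa [startVertex, overOut] using (hall (D.overOut c)).symm
  have h1 := LinearMap.finrank_range_add_finrank_ker D.vertexCoboundary
  have h2 : Module.finrank (ZMod 2) (LinearMap.ker D.vertexCoboundary) ≤ 1 :=
    (Submodule.finrank_mono hker).trans ((finrank_span_le_card _).trans (by simp))
  have h3 : 0 < Module.finrank (ZMod 2) (LinearMap.ker D.vertexCoboundary) := by
    rw [Module.finrank_pos_iff, Submodule.nontrivial_iff_ne_bot, Submodule.ne_bot_iff]
    exact ⟨fun _ => 1, LinearMap.mem_ker.2 (funext fun e => CharTwo.add_self_eq_zero _),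
      fun h => one_ne_zero (congrFun h none)⟩
  simp at h1
  omega

theorem faceBoundary_ker :
    LinearMap.ker D.faceBoundary ≤ Submodule.span (ZMod 2) {fun _ => 1} := by
  intro g hg
  have hlr : ∀ e, g (Quot.mk _ (e, true)) = g (Quot.mk _ (e, false)) := fun e =>
    CharTwo.add_eq_zero.1 (congrFun (LinearMap.mem_ker.1 hg) e)
  have hl (c) : g (Quot.mk _ (D.bottomLeft c, true)) = g (Quot.mk _ (D.topLeft c, true)) :=
    congrArg g (Quot.sound (.left c))
  have hr (c) : g (Quot.mk _ (D.bottomRight c, false)) = g (Quot.mk _ (D.topRight c, false)) :=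
    congrArg g (Quot.sound (.right c))
  have hb (c) : g (Quot.mk _ (D.bottomLeft c, false)) = g (Quot.mk _ (D.bottomRight c, true)) :=
    congrArg g (Quot.sound (.bottom c))
  have hstep : ∀ j : Fin (2 * D.n),
      g (Quot.mk _ (j.succ, true)) = g (Quot.mk _ (j.castSucc, true)) := by
    intro j
    obtain ⟨c, rfl | rfl⟩ := D.eq_overPos_or_eq_underPos j <;>
    · have := hl c; have := hr c; have := hb c
      have := hlr (D.bottomLeft c); have := hlr (D.bottomRight c)
      have := hlr (D.topLeft c); have := hlr (D.topRight c)
      cases hc : D.positive c <;>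
        simp_all [bottomLeft, bottomRight, topLeft, topRight, overIn, overOut, underIn, underOut]
  have hall : ∀ e, g (Quot.mk _ (e, true)) = g (Quot.mk _ (0, true)) := by
    intro e
    induction e using Fin.induction with
    | zero => rfl
    | succ j ih => rw [hstep, ih]
  refine Submodule.mem_span_singleton.2 ⟨g (Quot.mk _ (0, true)), funext fun f => ?_⟩
  induction f using Quot.ind with
  | mk p =>
    obtain ⟨e, s⟩ := p
    cases s
    · simp [← hlr, hall e]
    · simp [hall e]

theorem vertexCoboundary_dotProduct_faceBoundary (h : Option (Fin D.n) → ZMod 2)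
    (g : D.Face → ZMod 2) : D.vertexCoboundary h ⬝ᵥ D.faceBoundary g = 0 := by
  have hcross (c : Fin D.n) : D.faceBoundary g (D.overIn c) + D.faceBoundary g (D.overOut c) +
      D.faceBoundary g (D.underIn c) + D.faceBoundary g (D.underOut c) = 0 := by
    have h1 : D.faceBoundary g (D.overIn c) + D.faceBoundary g (D.overOut c) +
        D.faceBoundary g (D.underIn c) + D.faceBoundary g (D.underOut c) =
        D.faceBoundary g (D.bottomLeft c) + D.faceBoundary g (D.topRight c) +
        D.faceBoundary g (D.bottomRight c) + D.faceBoundary g (D.topLeft c) := by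
      cases hc : D.positive c
      · simp only [bottomLeft, bottomRight, topLeft, topRight, hc]
        simp only [Bool.false_eq_true, if_false]
        ring
      · simp only [bottomLeft, bottomRight, topLeft, topRight, hc]
        simp only [if_true]
    rw [h1]
    have hl : g (Quot.mk _ (D.bottomLeft c, true)) = g (Quot.mk _ (D.topLeft c, true)) :=
      congrArg g (Quot.sound (.left c))
    have hr : g (Quot.mk _ (D.bottomRight c, false)) = g (Quot.mk _ (D.topRight c, false)) :=
      congrArg g (Quot.sound (.right c))
    have hb : g (Quot.mk _ (D.bottomLeft c, false)) = g (Quot.mk _ (D.bottomRight c, true)) :=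
      congrArg g (Quot.sound (.bottom c))
    have ht : g (Quot.mk _ (D.topLeft c, false)) = g (Quot.mk _ (D.topRight c, true)) :=
      congrArg g (Quot.sound (.top c))
    simp only [faceBoundary, LinearMap.add_apply, Pi.add_apply, LinearMap.funLeft_apply]
    rw [hl, hr, hb, ht]
    ring_nf
    simp [show (2 : ZMod 2) = 0 from rfl]
  have hbase : D.faceBoundary g 0 + D.faceBoundary g (Fin.last _) = 0 := by
    have h1 (s : Bool) : g (Quot.mk _ (Fin.last _, s)) = g (Quot.mk _ (0, s)) :=
      congrArg g (Quot.sound (.base s))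
    simp only [faceBoundary, LinearMap.add_apply, Pi.add_apply, LinearMap.funLeft_apply]
    rw [h1, h1]
    exact CharTwo.add_self_eq_zero _
  rw [vertexCoboundary_dotProduct, hbase]
  simp [hcross]

end GaussCode

namespace KnotDiagram

variable (D : KnotDiagram)

/-- A planar diagram has a checkerboard colouring: the faces are coloured with two colours so that
the two sides of every edge have different colours. On the sphere the constant function `1` on the
edges bounds, because it is a cycle: all vertices have even degree. -/
theorem exists_checkerboard : ∃ g : D.Face → ZMod 2, ∀ e, D.faceBoundary g e = 1 := by
  classical
  let B : LinearMap.BilinForm (ZMod 2) (D.Edge → ZMod 2) := Matrix.toBilin' 1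
  have hB : ∀ x y, B x y = x ⬝ᵥ y := fun x y => by
    simp [B, Matrix.toBilin'_apply']
  have hnd : B.Nondegenerate := Matrix.Nondegenerate.toBilin' (Matrix.nondegenerate_of_det_ne_zero (by simp))
  have hle : LinearMap.range D.faceBoundary ≤
      B.orthogonal (LinearMap.range D.vertexCoboundary) := by
    rintro _ ⟨g, rfl⟩ _ ⟨h, rfl⟩
    exact (hB _ _).trans (D.vertexCoboundary_dotProduct_faceBoundary h g)
  have hface : Finite D.Face := Quot.finite _
  have : Fintype D.Face := Fintype.ofFinite _
  have hrank : D.n + 1 ≤ Module.finrank (ZMod 2) (LinearMap.range D.faceBoundary) := by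
    have h1 := LinearMap.finrank_range_add_finrank_ker D.faceBoundary
    have h2 : Module.finrank (ZMod 2) (LinearMap.ker D.faceBoundary) ≤ 1 :=
      (Submodule.finrank_mono D.faceBoundary_ker).trans ((finrank_span_le_card _).trans (by simp))
    rw [Module.finrank_fintype_fun_eq_card, ← Nat.card_eq_fintype_card, D.planar] at h1
    omega
  have heq := Submodule.eq_of_le_of_finrank_le hle (by
    rw [LinearMap.BilinForm.finrank_orthogonal hnd, D.finrank_range_vertexCoboundary]
    simp
    omega)
  have hone : (fun _ => 1 : D.Edge → ZMod 2) ∈ LinearMap.range D.faceBoundary := by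
    rw [heq]
    rintro _ ⟨h, rfl⟩
    refine (hB _ _).trans ((D.vertexCoboundary_dotProduct h _).trans ?_)
    have h2 : (1 + 1 : ZMod 2) = 0 := rfl
    simp [h2]
  obtain ⟨g, hg⟩ := hone
  exact ⟨g, congrFun hg⟩

open GaussCode in
/-- Between the two passages through a crossing of a planar diagram one meets an even number of
passages. The checkerboard colour on the left of the knot changes at every passage, and it differs on
the two strands that arrive at a crossing. -/
theorem even_overPos_iff (c : Fin D.n) : Even (D.overPos c : ℕ) ↔ ¬ Even (D.underPos c : ℕ) := by
  obtain ⟨g, hg⟩ := D.exists_checkerboard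
  have hlr : ∀ e, g (Quot.mk _ (e, true)) = g (Quot.mk _ (e, false)) + 1 := fun e => by
    have h1 : g (Quot.mk _ (e, true)) + g (Quot.mk _ (e, false)) = 1 := hg e
    rw [← h1, add_left_comm, CharTwo.add_self_eq_zero, add_zero]
  have hl (c) : g (Quot.mk _ (D.bottomLeft c, true)) = g (Quot.mk _ (D.topLeft c, true)) :=
    congrArg g (Quot.sound (.left c))
  have hr (c) : g (Quot.mk _ (D.bottomRight c, false)) = g (Quot.mk _ (D.topRight c, false)) :=
    congrArg g (Quot.sound (.right c))
  have hb (c) : g (Quot.mk _ (D.bottomLeft c, true)) =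
      g (Quot.mk _ (D.bottomRight c, true)) + 1 := by
    rw [hlr]
    exact congrArg (g · + 1) (Quot.sound (.bottom c))
  have hr' (c) : g (Quot.mk _ (D.bottomRight c, true)) = g (Quot.mk _ (D.topRight c, true)) := by
    rw [hlr, hlr, hr]
  have hstep : ∀ j : Fin (2 * D.n),
      g (Quot.mk _ (j.succ, true)) = g (Quot.mk _ (j.castSucc, true)) + 1 := by
    have h11 : ∀ a : ZMod 2, a + 1 + 1 = a := by decide
    intro j
    obtain ⟨c, rfl | rfl⟩ := D.eq_overPos_or_eq_underPos j <;>
    · have h1 := hl c; have h2 := hr' c; have h3 := hb c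
      clear hlr hl hr hb hr' hg
      cases hc : D.positive c <;>
        simp_all [bottomLeft, bottomRight, topLeft, topRight, overIn, overOut, underIn, underOut]
  have hall : ∀ e, g (Quot.mk _ (e, true)) = g (Quot.mk _ (0, true)) + (e : ℕ) := by
    intro e
    induction e using Fin.induction with
    | zero => simp
    | succ j ih => rw [hstep, ih]; simp [add_assoc]
  have hne : g (Quot.mk _ (D.overIn c, true)) = g (Quot.mk _ (D.underIn c, true)) + 1 := by
    have h11 : ∀ a : ZMod 2, a + 1 + 1 = a := by decide
    have h3 := hb c
    clear hlr hl hr hb hr' hg hall hstep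
    cases hc : D.positive c <;> simp_all [bottomLeft, bottomRight]
  rw [hall (D.overIn c), hall (D.underIn c), add_assoc, add_right_inj] at hne
  simp only [overIn, underIn, Fin.val_castSucc] at hne
  rw [← ZMod.natCast_eq_zero_iff_even, ← ZMod.natCast_eq_zero_iff_even, hne]
  generalize ((D.underPos c : ℕ) : ZMod 2) = a
  revert a
  decide

end KnotDiagram

/-! ### The circles of a resolution as cycles of a permutation -/

namespace Equiv.Perm

variable {α : Type*} [Finite α]

theorem not_sameCycle_of_pow_apply_eq_self (σ : Perm α) {i j : α} {k : ℕ} (hk : 0 < k)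
    (hi : (σ ^ k) i = i) (hj : ∀ m < k, (σ ^ m) i ≠ j) : ¬ σ.SameCycle i j := by
  intro h
  obtain ⟨r, hr⟩ := h.exists_nat_pow_eq
  refine hj (r % k) (Nat.mod_lt _ hk) ?_
  have h1 : ∀ q : ℕ, ((σ ^ k) ^ q) i = i := fun q => by
    rw [Perm.pow_apply_eq_self_of_apply_eq_self hi]
  rw [← Nat.mod_add_div r k, pow_add, Perm.mul_apply, pow_mul, h1] at hr
  exact hr

/-- Multiplication by a transposition of two points cuts their common cycle into two cycles, one
through each of the points, or joins their two cycles to one. -/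
theorem sameCycle_mul_swap_iff [DecidableEq α] (σ : Perm α) {i j : α} (hij : i ≠ j) :
    (σ * swap i j).SameCycle i j ↔ ¬ σ.SameCycle i j := by
  set τ := σ * swap i j with hτ
  have hex : ∃ k, 0 < k ∧ ((σ ^ k) i = i ∨ (σ ^ k) i = j) :=
    ⟨orderOf σ, orderOf_pos σ, by simp [pow_orderOf_eq_one]⟩
  -- the first return of the orbit of `i` to one of the two points
  obtain ⟨hk, hret⟩ := Nat.find_spec hex
  have hmin := fun m => Nat.find_min hex (m := m)
  set k := Nat.find hex
  have hpow : ∀ m, 0 < m → m ≤ k → (τ ^ m) j = (σ ^ m) i := by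
    intro m
    induction m with
    | zero => intro h; omega
    | succ m ih =>
      intro _ hmk
      rcases Nat.eq_zero_or_pos m with rfl | hm
      · simp [hτ]
      · have hne := hmin m (by omega)
        rw [pow_succ', Perm.mul_apply, ih hm (by omega), hτ, Perm.mul_apply,
          swap_apply_of_ne_of_ne (fun h => hne ⟨hm, Or.inl h⟩) (fun h => hne ⟨hm, Or.inr h⟩),
          ← Perm.mul_apply, ← pow_succ']
  rcases hret with h | h
  · refine iff_of_true ?_ (not_sameCycle_of_pow_apply_eq_self σ hk h fun m hm h' => ?_)
    · exact (show τ.SameCycle j i from ⟨k, by simp [hpow k hk le_rfl, h]⟩).symm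
    · rcases Nat.eq_zero_or_pos m with rfl | hm0
      · exact hij h'
      · exact hmin m hm ⟨hm0, Or.inr h'⟩
  · refine iff_of_false (fun h' => ?_) (not_not.2 ⟨k, by simp [h]⟩)
    refine not_sameCycle_of_pow_apply_eq_self τ hk ((hpow k hk le_rfl).trans h)
      (fun m hm h'' => ?_) h'.symm
    rcases Nat.eq_zero_or_pos m with rfl | hm0
    · exact hij h''.symm
    · exact hmin m hm ⟨hm0, Or.inl ((hpow m hm0 hm.le).symm.trans h'')⟩

end Equiv.Perm

namespace GaussCode

variable (D : GaussCode)

/-- The passage of a crossing with even position. -/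
def evenPos (c : Fin D.n) : Fin (2 * D.n) :=
  if Even (D.overPos c : ℕ) then D.overPos c else D.underPos c

/-- The passage of a crossing other than `evenPos`. -/
def oddPos (c : Fin D.n) : Fin (2 * D.n) :=
  if Even (D.overPos c : ℕ) then D.underPos c else D.overPos c

/-- Reverse the edges with odd numbers. Then two edges arrive at every crossing `c`, at its even
passage: `inEdge (c, false)` before and `inEdge (c, true)` after the passage. -/
def inEdge : Option (Fin D.n × Bool) → D.Edge
  | none => Fin.last _
  | some (c, false) => (D.evenPos c).castSucc
  | some (c, true) => (D.evenPos c).succ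

/-- After reversing the edges with odd numbers, two edges leave every crossing, at its odd passage.
They are numbered so that the oriented smoothing joins `inEdge (c, b)` to `outEdge (c, b)`. -/
def outEdge : Option (Fin D.n × Bool) → D.Edge
  | none => 0
  | some (c, false) => (D.oddPos c).succ
  | some (c, true) => (D.oddPos c).castSucc

/-- The exchange of the two outgoing edges at the crossings where the smoothing does not respect the
orientation. -/
def twist (v : D.State) : Equiv.Perm (Option (Fin D.n × Bool)) :=
  Equiv.optionCongr (Function.Involutive.toPerm
    (fun x : Fin D.n × Bool => (x.1, xor x.2 (v x.1 == D.positive x.1))) fun x => by simp)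

@[simp] theorem twist_some (v : D.State) (c : Fin D.n) (b : Bool) :
    D.twist v (some (c, b)) = some (c, xor b (v c == D.positive c)) := rfl

theorem circle_eq_iff {v : D.State} {e f : D.Edge} :
    D.circle v e = D.circle v f ↔ Relation.EqvGen (D.Joined v) e f := Quot.eq

theorem circle_underIn_or (v : D.State) (c : Fin D.n) (e : D.Edge)
    (he : e = D.underIn c ∨ e = D.underOut c ∨ e = D.overIn c ∨ e = D.overOut c) :
    D.circle v e = D.circle v (D.underIn c) ∨ D.circle v e = D.circle v (D.underOut c) := by
  rcases he with rfl | rfl | rfl | rfl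
  · exact Or.inl rfl
  · exact Or.inr rfl
  · by_cases h : v c = D.positive c
    · exact Or.inl (Quot.sound (.unoriented_in c h)).symm
    · exact Or.inr (Quot.sound (.oriented_over c h))
  · by_cases h : v c = D.positive c
    · exact Or.inr (Quot.sound (.unoriented_out c h)).symm
    · exact Or.inl (Quot.sound (.oriented_under c h)).symm

/-- Changing the smoothing of `c` affects only the circles through `c`. -/
theorem circle_eq_or_of_circle_eq {v w : D.State} {c : Fin D.n}
    (hvw : ∀ c', c' ≠ c → w c' = v c') {e f : D.Edge} (hef : D.circle w e = D.circle w f) :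
    D.circle v e = D.circle v f ∨
      (D.circle v e = D.circle v (D.underIn c) ∨ D.circle v e = D.circle v (D.underOut c)) ∧
      (D.circle v f = D.circle v (D.underIn c) ∨ D.circle v f = D.circle v (D.underOut c)) := by
  have key := D.circle_eq_iff.1 hef
  clear hef
  induction key with
  | refl x => exact Or.inl rfl
  | symm x y _ ih => exact ih.imp Eq.symm And.symm
  | trans x y z _ _ ih₁ ih₂ =>
    rcases ih₁ with h | ⟨h1, h2⟩
    · rw [h]; exact ih₂
    · rcases ih₂ with h | ⟨h3, h4⟩
      · rw [← h]; exact Or.inr ⟨h1, h2⟩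
      · exact Or.inr ⟨h1, h4⟩
  | rel x y hxy =>
    cases hxy with
    | base => exact Or.inl (Quot.sound .base)
    | oriented_under c' hc' =>
      by_cases hcc : c' = c
      · subst hcc
        exact Or.inr ⟨D.circle_underIn_or v c' _ (by simp), D.circle_underIn_or v c' _ (by simp)⟩
      · exact Or.inl (Quot.sound (.oriented_under c' (hvw c' hcc ▸ hc')))
    | oriented_over c' hc' =>
      by_cases hcc : c' = c
      · subst hcc
        exact Or.inr ⟨D.circle_underIn_or v c' _ (by simp), D.circle_underIn_or v c' _ (by simp)⟩
      · exact Or.inl (Quot.sound (.oriented_over c' (hvw c' hcc ▸ hc')))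
    | unoriented_in c' hc' =>
      by_cases hcc : c' = c
      · subst hcc
        exact Or.inr ⟨D.circle_underIn_or v c' _ (by simp), D.circle_underIn_or v c' _ (by simp)⟩
      · exact Or.inl (Quot.sound (.unoriented_in c' (hvw c' hcc ▸ hc')))
    | unoriented_out c' hc' =>
      by_cases hcc : c' = c
      · subst hcc
        exact Or.inr ⟨D.circle_underIn_or v c' _ (by simp), D.circle_underIn_or v c' _ (by simp)⟩
      · exact Or.inl (Quot.sound (.unoriented_out c' (hvw c' hcc ▸ hc')))

theorem circle_eq_of_circle_eq {v w : D.State} {c : Fin D.n}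
    (hvw : ∀ c', c' ≠ c → w c' = v c') (hv : D.circle v (D.underIn c) = D.circle v (D.underOut c))
    {e f : D.Edge} (hef : D.circle w e = D.circle w f) : D.circle v e = D.circle v f := by
  rcases D.circle_eq_or_of_circle_eq hvw hef with h | ⟨h1, h2⟩
  · exact h
  · rw [← hv, or_self] at h1 h2
    rw [h1, h2]

theorem card_circle_eq_add_one {v w : D.State} {c : Fin D.n}
    (hvw : ∀ c', c' ≠ c → w c' = v c') (hv : D.circle v (D.underIn c) ≠ D.circle v (D.underOut c))
    (hw : D.circle w (D.underIn c) = D.circle w (D.underOut c)) :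
    Nat.card (D.Circle v) = Nat.card (D.Circle w) + 1 := by
  classical
  have hle : ∀ e f, D.circle v e = D.circle v f → D.circle w e = D.circle w f := fun e f =>
    D.circle_eq_of_circle_eq (fun c' hc' => (hvw c' hc').symm) hw
  have : Finite (D.Circle v) := Quot.finite _
  have : Fintype (D.Circle v) := Fintype.ofFinite _
  let φ : D.Circle v → D.Circle w :=
    Quot.lift (D.circle w) fun e f hef => hle e f (Quot.sound hef)
  have hφ : ∀ e, φ (D.circle v e) = D.circle w e := fun _ => rfl
  have hbij : Function.Bijective
      (fun q : {q : D.Circle v // q ≠ D.circle v (D.underOut c)} => φ q) := by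
    constructor
    · rintro ⟨⟨e⟩, he⟩ ⟨⟨f⟩, hf⟩ hef
      refine Subtype.ext ?_
      rcases D.circle_eq_or_of_circle_eq hvw (hef : D.circle w e = D.circle w f) with h | ⟨h1, h2⟩
      · exact h
      · exact (h1.resolve_right he).trans (h2.resolve_right hf).symm
    · rintro ⟨e⟩
      by_cases he : D.circle v e = D.circle v (D.underOut c)
      · exact ⟨⟨_, hv⟩, hw.trans (hle _ _ he).symm⟩
      · exact ⟨⟨_, he⟩, rfl⟩
  rw [← Nat.card_eq_of_bijective _ hbij, Nat.card_eq_fintype_card, Nat.card_eq_fintype_card,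
    Fintype.card_subtype_compl, Fintype.card_subtype_eq]
  have : 0 < Fintype.card (D.Circle v) := Fintype.card_pos_iff.2 ⟨D.circle v 0⟩
  omega

end GaussCode

namespace KnotDiagram

open GaussCode

variable (D : KnotDiagram)

theorem exists_evenPos_eq {j : Fin (2 * D.n)} (hj : Even (j : ℕ)) : ∃ c, D.evenPos c = j := by
  obtain ⟨c, rfl | rfl⟩ := D.eq_overPos_or_eq_underPos j
  · exact ⟨c, if_pos hj⟩
  · exact ⟨c, if_neg fun h => (D.even_overPos_iff c).1 h hj⟩

theorem exists_oddPos_eq {j : Fin (2 * D.n)} (hj : ¬ Even (j : ℕ)) : ∃ c, D.oddPos c = j := by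
  obtain ⟨c, rfl | rfl⟩ := D.eq_overPos_or_eq_underPos j
  · exact ⟨c, if_neg hj⟩
  · exact ⟨c, if_pos ((D.even_overPos_iff c).2 hj)⟩

theorem inEdge_bijective : Function.Bijective D.inEdge := by
  refine (Fintype.bijective_iff_surjective_and_card _).2 ⟨fun e => ?_, by simp [mul_comm]⟩
  by_cases he : Even (e : ℕ)
  · induction e using Fin.lastCases with
    | last => exact ⟨none, rfl⟩
    | cast j =>
      obtain ⟨c, rfl⟩ := D.exists_evenPos_eq (j := j) (by simpa using he)
      exact ⟨some (c, false), rfl⟩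
  · induction e using Fin.cases with
    | zero => simp at he
    | succ j =>
      obtain ⟨c, rfl⟩ := D.exists_evenPos_eq (j := j) (by
        rw [Fin.val_succ, Nat.even_add_one, not_not] at he
        exact he)
      exact ⟨some (c, true), rfl⟩

theorem outEdge_bijective : Function.Bijective D.outEdge := by
  refine (Fintype.bijective_iff_surjective_and_card _).2 ⟨fun e => ?_, by simp [mul_comm]⟩
  by_cases he : Even (e : ℕ)
  · induction e using Fin.cases with
    | zero => exact ⟨none, rfl⟩
    | succ j =>
      obtain ⟨c, rfl⟩ := D.exists_oddPos_eq (j := j) (by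
        rwa [Fin.val_succ, Nat.even_add_one] at he)
      exact ⟨some (c, false), rfl⟩
  · induction e using Fin.lastCases with
    | last => simp at he
    | cast j =>
      obtain ⟨c, rfl⟩ := D.exists_oddPos_eq (j := j) (by simpa using he)
      exact ⟨some (c, true), rfl⟩

/-- The permutation of the edges whose cycles are the circles of a resolution. After reversing the
edges with odd numbers, every smoothing of every crossing joins an incoming to an outgoing edge. -/
noncomputable def next (v : D.State) : Equiv.Perm D.Edge :=
  (Equiv.ofBijective _ D.inEdge_bijective).symm.trans
    ((D.twist v).trans (Equiv.ofBijective _ D.outEdge_bijective))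

theorem next_inEdge (v : D.State) (x : Option (Fin D.n × Bool)) :
    D.next v (D.inEdge x) = D.outEdge (D.twist v x) := by
  have h : (Equiv.ofBijective _ D.inEdge_bijective).symm (D.inEdge x) = x :=
    (Equiv.ofBijective _ D.inEdge_bijective).symm_apply_apply x
  simp only [next, Equiv.trans_apply, h, Equiv.ofBijective_apply]

theorem next_eq_mul_swap {v w : D.State} {c : Fin D.n} (hvw : ∀ c', c' ≠ c → w c' = v c')
    (hc : w c ≠ v c) : D.next w = D.next v *
      Equiv.swap (D.inEdge (some (c, false))) (D.inEdge (some (c, true))) := by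
  ext1 e
  obtain ⟨x, rfl⟩ := D.inEdge_bijective.2 e
  rw [Equiv.Perm.mul_apply, ← D.inEdge_bijective.1.map_swap, next_inEdge, next_inEdge]
  congr 1
  rcases x with _ | ⟨c', b⟩
  · rw [Equiv.swap_apply_of_ne_of_ne (by simp) (by simp)]
    rfl
  · by_cases h : c' = c
    · subst h
      have hw : w c' = !v c' := Bool.eq_not.2 hc
      cases b <;> cases h1 : v c' <;> cases h2 : D.positive c' <;>
        simp [hw, h1, h2]
    · rw [Equiv.swap_apply_of_ne_of_ne (by simp [h]) (by simp [h])]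
      simp [hvw c' h]

theorem circle_next (v : D.State) (e : D.Edge) : D.circle v (D.next v e) = D.circle v e := by
  obtain ⟨x, rfl⟩ := D.inEdge_bijective.2 e
  rw [next_inEdge]
  rcases x with _ | ⟨c, b⟩
  · exact (Quot.sound .base).symm
  · rw [twist_some]
    by_cases hp : v c = D.positive c
    · have h1 : D.circle v (D.underIn c) = D.circle v (D.overIn c) :=
        Quot.sound (.unoriented_in c hp)
      have h2 : D.circle v (D.underOut c) = D.circle v (D.overOut c) :=
        Quot.sound (.unoriented_out c hp)
      simp only [overIn, overOut, underIn, underOut] at h1 h2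
      by_cases h : Even (D.overPos c : ℕ) <;> cases b <;>
        simp [inEdge, outEdge, evenPos, oddPos, h, hp, h1, h2]
    · have h1 : D.circle v (D.underIn c) = D.circle v (D.overOut c) :=
        Quot.sound (.oriented_under c hp)
      have h2 : D.circle v (D.overIn c) = D.circle v (D.underOut c) :=
        Quot.sound (.oriented_over c hp)
      simp only [overIn, overOut, underIn, underOut] at h1 h2
      by_cases h : Even (D.overPos c : ℕ) <;> cases b <;>
        simp [inEdge, outEdge, evenPos, oddPos, h, beq_eq_false_iff_ne.2 hp, h1, h2]

theorem sameCycle_next_of_joined {v : D.State} {e f : D.Edge} (h : D.Joined v e f) :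
    (D.next v).SameCycle e f := by
  have hn : ∀ {e f}, D.next v e = f → (D.next v).SameCycle e f := by
    rintro e _ rfl
    exact Equiv.Perm.sameCycle_apply_right.2 (.refl _ _)
  have h1 := fun c => D.next_inEdge v (some (c, false))
  have h2 := fun c => D.next_inEdge v (some (c, true))
  cases h with
  | base => exact hn (D.next_inEdge v none)
  | oriented_under c hc =>
    specialize h1 c; specialize h2 c
    by_cases h : Even (D.overPos c : ℕ) <;>
      simp [inEdge, outEdge, evenPos, oddPos, h, beq_eq_false_iff_ne.2 hc] at h1 h2
    · exact (hn h2).symm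
    · exact hn h1
  | oriented_over c hc =>
    specialize h1 c; specialize h2 c
    by_cases h : Even (D.overPos c : ℕ) <;>
      simp [inEdge, outEdge, evenPos, oddPos, h, beq_eq_false_iff_ne.2 hc] at h1 h2
    · exact hn h1
    · exact (hn h2).symm
  | unoriented_in c hc =>
    specialize h1 c; specialize h2 c
    by_cases h : Even (D.overPos c : ℕ) <;>
      simp [inEdge, outEdge, evenPos, oddPos, h, hc] at h1 h2
    · exact (hn h1).symm
    · exact hn h1
  | unoriented_out c hc =>
    specialize h1 c; specialize h2 c
    by_cases h : Even (D.overPos c : ℕ) <;>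
      simp [inEdge, outEdge, evenPos, oddPos, h, hc] at h1 h2
    · exact (hn h2).symm
    · exact hn h2

theorem circle_eq_iff_sameCycle {v : D.State} {e f : D.Edge} :
    D.circle v e = D.circle v f ↔ (D.next v).SameCycle e f := by
  constructor
  · intro h
    have key := D.circle_eq_iff.1 h
    clear h
    induction key with
    | rel x y hxy => exact D.sameCycle_next_of_joined hxy
    | refl x => exact .refl _ _
    | symm x y _ ih => exact ih.symm
    | trans x y z _ _ ih₁ ih₂ => exact ih₁.trans ih₂
  · intro h
    obtain ⟨k, rfl⟩ := h.exists_nat_pow_eq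
    induction k with
    | zero => rfl
    | succ k ih =>
      rw [pow_succ', Equiv.Perm.mul_apply, circle_next]
      exact ih ⟨k, rfl⟩

theorem circle_under_eq_iff_inEdge (v : D.State) (c : Fin D.n) :
    D.circle v (D.underIn c) = D.circle v (D.underOut c) ↔
      D.circle v (D.inEdge (some (c, false))) = D.circle v (D.inEdge (some (c, true))) := by
  by_cases h : Even (D.overPos c : ℕ)
  · rw [← D.circle_next v (D.inEdge (some (c, false))), ← D.circle_next v (D.inEdge (some (c, true))),
      next_inEdge, next_inEdge, twist_some, twist_some]
    by_cases hp : v c = D.positive c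
    · simp [outEdge, oddPos, h, hp, underIn, underOut]
    · simp [outEdge, oddPos, h, beq_eq_false_iff_ne.2 hp, underIn, underOut, eq_comm]
  · simp [inEdge, evenPos, h, underIn, underOut]

/-- Changing the smoothing of a crossing of a planar diagram either merges two circles or splits one
circle: the two strands at the crossing lie on one circle either before or after the change, and
never on both sides. -/
theorem circle_under_eq_iff_ne {v w : D.State} {c : Fin D.n} (hvw : ∀ c', c' ≠ c → w c' = v c')
    (hc : w c ≠ v c) : D.circle w (D.underIn c) = D.circle w (D.underOut c) ↔
      D.circle v (D.underIn c) ≠ D.circle v (D.underOut c) := by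
  rw [Ne, circle_under_eq_iff_inEdge, circle_under_eq_iff_inEdge, circle_eq_iff_sameCycle,
    circle_eq_iff_sameCycle, D.next_eq_mul_swap hvw hc, Equiv.Perm.sameCycle_mul_swap_iff]
  exact fun h => by simpa using D.inEdge_bijective.1 h

end KnotDiagram

/-! ### The square of the differential and the degrees of the edge maps -/

namespace GaussCode

variable (D : GaussCode) {R : Type*} [CommRing R] (h t : R)

theorem edgeFactor_of_eq {v : D.State} {c : Fin D.n}
    (hc : D.circle v (D.underIn c) = D.circle v (D.underOut c)) : D.edgeFactor h v c = 1 :=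
  if_pos hc

theorem edgeFactor_of_ne {v : D.State} {c : Fin D.n}
    (hc : D.circle v (D.underIn c) ≠ D.circle v (D.underOut c)) : D.edgeFactor h v c =
      MvPolynomial.X (D.underIn c) + MvPolynomial.X (D.underOut c) - MvPolynomial.C h :=
  if_neg hc

/-- The chain represented by a family of polynomials. -/
noncomputable def toChain (p : D.State → D.EdgeRing R) : D.Chain h t :=
  fun v => D.toStateModule h t v (p v)

theorem toChain_surjective : Function.Surjective (D.toChain h t) := fun x =>
  ⟨fun v => (Submodule.mkQ_surjective (D.stateIdeal h t v) (x v)).choose,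
    funext fun v => (Submodule.mkQ_surjective (D.stateIdeal h t v) (x v)).choose_spec⟩

theorem toStateModule_eq_zero_iff {v : D.State} {p : D.EdgeRing R} :
    D.toStateModule h t v p = 0 ↔ p ∈ D.stateIdeal h t v :=
  Submodule.Quotient.mk_eq_zero _

/-- The sign of an edge of the cube. -/
def cubeSign (v : D.State) (c : Fin D.n) : ℤ :=
  (-1) ^ (Finset.univ.filter fun c' => c' < c ∧ v c' = true).card

theorem d_toChain (p : D.State → D.EdgeRing R) (v : D.State) :
    D.d h t (D.toChain h t p) v = ∑ c with v c = true,
      D.cubeSign v c • D.toStateModule h t v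
        (p (Function.update v c false) * D.edgeFactor h v c) := by
  simp only [d, LinearMap.pi_apply, LinearMap.sum_apply]
  rfl

theorem d_toChain_eq (p : D.State → D.EdgeRing R) :
    D.d h t (D.toChain h t p) = D.toChain h t fun v => ∑ c with v c = true,
      D.cubeSign v c • (p (Function.update v c false) * D.edgeFactor h v c) := by
  funext v
  rw [d_toChain, toChain, map_sum]
  exact Finset.sum_congr rfl fun c _ => (map_zsmul _ _ _).symm

theorem card_filter_lt_update (v : D.State) {c : Fin D.n} (hc : v c = true) (e : Fin D.n) :
    (Finset.univ.filter fun c' => c' < e ∧ v c' = true).card =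
      (Finset.univ.filter fun c' => c' < e ∧ Function.update v c false c' = true).card +
        if c < e then 1 else 0 := by
  split_ifs with he
  · rw [← Finset.card_insert_of_notMem (a := c) (by simp)]
    congr 1
    ext x
    rcases eq_or_ne x c with rfl | hx
    · simp [hc, he]
    · simp [hx]
  · rw [add_zero]
    congr 1
    ext x
    rcases eq_or_ne x c with rfl | hx
    · simp [he]
    · simp [hx]

theorem cubeSign_mul_cubeSign_update {v : D.State} {c c' : Fin D.n} (hcc : c ≠ c')
    (hc : v c = true) (hc' : v c' = true) :
    D.cubeSign v c * D.cubeSign (Function.update v c false) c' =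
      -(D.cubeSign v c' * D.cubeSign (Function.update v c' false) c) := by
  simp only [cubeSign]
  rw [D.card_filter_lt_update v hc c', D.card_filter_lt_update v hc' c]
  rcases lt_or_gt_of_ne hcc with h | h
  · rw [if_pos h, if_neg h.not_gt]; ring
  · rw [if_pos h, if_neg h.not_gt]; ring

theorem card_filter_update (v : D.State) {c : Fin D.n} (hc : v c = true) :
    (Finset.univ.filter fun c' => v c' = true).card =
      (Finset.univ.filter fun c' => Function.update v c false c' = true).card + 1 := by
  rw [← Finset.card_insert_of_notMem (a := c) (by simp)]
  congr 1
  ext x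
  rcases eq_or_ne x c with rfl | hx
  · simp [hc]
  · simp [hx]

end GaussCode

namespace KnotDiagram

open GaussCode

variable (D : KnotDiagram) {R : Type*} [CommRing R] (h t : R)

theorem edgeFactor_comm_of_ne {v : D.State} {c c' : Fin D.n}
    (hA' : D.circle v (D.underIn c') ≠ D.circle v (D.underOut c'))
    (hA : D.circle v (D.underIn c) = D.circle v (D.underOut c))
    (hc' : v c' = true) :
    D.edgeFactor h (Function.update v c false) c' * D.edgeFactor h v c =
      D.edgeFactor h (Function.update v c' false) c * D.edgeFactor h v c' := by
  have hw : ∀ e, e ≠ c → Function.update v c false e = v e := fun e he =>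
    Function.update_of_ne he _ _
  have hw' : ∀ e, e ≠ c' → Function.update v c' false e = v e := fun e he =>
    Function.update_of_ne he _ _
  have h1 := (D.circle_under_eq_iff_ne hw' (by simp [hc'])).2 hA'
  rw [D.edgeFactor_of_eq h hA, D.edgeFactor_of_ne h hA',
    D.edgeFactor_of_ne h fun hB => hA' (D.circle_eq_of_circle_eq hw hA hB),
    D.edgeFactor_of_eq h (D.circle_eq_of_circle_eq (fun e he => (hw' e he).symm) h1 hA)]
  ring

/-- The faces of the cube commute. -/
theorem edgeFactor_mul_sub_mem {v : D.State} {c c' : Fin D.n} (hcc : c ≠ c')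
    (hc : v c = true) (hc' : v c' = true) :
    D.edgeFactor h (Function.update v c false) c' * D.edgeFactor h v c -
      D.edgeFactor h (Function.update v c' false) c * D.edgeFactor h v c' ∈
        D.stateIdeal h t v := by
  by_cases hA : D.circle v (D.underIn c) = D.circle v (D.underOut c) <;>
    by_cases hA' : D.circle v (D.underIn c') = D.circle v (D.underOut c')
  rotate_left
  · rw [D.edgeFactor_comm_of_ne h hA' hA hc', sub_self]
    exact zero_mem _
  · rw [D.edgeFactor_comm_of_ne h hA hA' hc, sub_self]
    exact zero_mem _
  all_goals
    have hw : ∀ e, e ≠ c → Function.update v c false e = v e := fun e he =>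
      Function.update_of_ne he _ _
    have hw' : ∀ e, e ≠ c' → Function.update v c' false e = v e := fun e he =>
      Function.update_of_ne he _ _
    have hcw := D.circle_under_eq_iff_ne hw (by simp [hc])
    have hcw' := D.circle_under_eq_iff_ne hw' (by simp [hc'])
    set w := Function.update v c false with hwdef
    set w' := Function.update v c' false with hwdef'
  · -- two splittings
    have h1 := hcw.2 hA
    have h1' := hcw'.2 hA'
    have hle : ∀ {e f}, D.circle v e = D.circle v f → D.circle w e = D.circle w f :=
      D.circle_eq_of_circle_eq (fun e he => (hw e he).symm) h1
    have hle' : ∀ {e f}, D.circle v e = D.circle v f → D.circle w' e = D.circle w' f :=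
      D.circle_eq_of_circle_eq (fun e he => (hw' e he).symm) h1'
    rw [D.edgeFactor_of_ne h hA, D.edgeFactor_of_ne h hA']
    by_cases hB : D.circle w (D.underIn c') = D.circle w (D.underOut c')
    · have hab : D.circle v (D.underIn c') = D.circle v (D.underIn c) ∧
            D.circle v (D.underOut c') = D.circle v (D.underOut c) ∨
          D.circle v (D.underIn c') = D.circle v (D.underOut c) ∧
            D.circle v (D.underOut c') = D.circle v (D.underIn c) := by
        rcases (D.circle_eq_or_of_circle_eq (fun e he => hw e he) hB).resolve_left hA' with
          ⟨h2 | h2, h3 | h3⟩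
        · exact absurd (h2.trans h3.symm) hA'
        · exact Or.inl ⟨h2, h3⟩
        · exact Or.inr ⟨h2, h3⟩
        · exact absurd (h2.trans h3.symm) hA'
      have hB' : D.circle w' (D.underIn c) = D.circle w' (D.underOut c) := by
        rcases hab with ⟨h2, h3⟩ | ⟨h2, h3⟩
        · rw [← hle' h2, ← hle' h3, h1']
        · rw [← hle' h2, ← hle' h3, h1']
      rw [D.edgeFactor_of_eq h hB, D.edgeFactor_of_eq h hB', one_mul, one_mul]
      rcases hab with ⟨h2, h3⟩ | ⟨h2, h3⟩ <;>
      · convert neg_mem (add_mem (D.sub_mem_stateIdeal h t h2) (D.sub_mem_stateIdeal h t h3))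
          using 1
        ring
    · have hB' : D.circle w' (D.underIn c) ≠ D.circle w' (D.underOut c) := by
        intro hB'
        rcases (D.circle_eq_or_of_circle_eq (fun e he => hw' e he) hB').resolve_left hA with
          ⟨h2 | h2, h3 | h3⟩
        · exact hA (h2.trans h3.symm)
        · exact hB (by rw [← hle h2, ← hle h3, h1])
        · exact hB (by rw [← hle h2, ← hle h3, h1])
        · exact hA (h2.trans h3.symm)
      rw [D.edgeFactor_of_ne h hB, D.edgeFactor_of_ne h hB']
      convert zero_mem (D.stateIdeal h t v) using 1
      ring
  · -- two merges
    have h1 : D.circle w (D.underIn c) ≠ D.circle w (D.underOut c) := fun h1 => hcw.1 h1 hA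
    have h1' : D.circle w' (D.underIn c') ≠ D.circle w' (D.underOut c') := fun h1 => hcw'.1 h1 hA'
    have hle : ∀ {e f}, D.circle w e = D.circle w f → D.circle v e = D.circle v f :=
      D.circle_eq_of_circle_eq hw hA
    have hcard := D.card_circle_eq_add_one (fun e he => (hw e he).symm) h1 hA
    have hcard' := D.card_circle_eq_add_one (fun e he => (hw' e he).symm) h1' hA'
    have hu : ∀ e, e ≠ c' → Function.update w c' false e = w e := fun e he =>
      Function.update_of_ne he _ _
    have huu : Function.update w c' false = Function.update w' c false :=
      Function.update_comm hcc.symm _ _ _ |>.symm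
    have hu' : ∀ e, e ≠ c → Function.update w c' false e = w' e := fun e he => by
      rw [huu]; exact Function.update_of_ne he _ _
    have hcu := D.circle_under_eq_iff_ne hu (by simp [hwdef, hcc.symm, hc'])
    have hcu' := D.circle_under_eq_iff_ne hu' (by rw [huu]; simp [hwdef', hcc, hc])
    set u := Function.update w c' false
    rw [D.edgeFactor_of_eq h hA, D.edgeFactor_of_eq h hA', mul_one, mul_one]
    -- the number of circles tells whether the other two edges of the square are merges
    have hcount : ∀ {e e' : Fin D.n} {x x' : D.State}, (∀ f, f ≠ e' → u f = x f) →
        (∀ f, f ≠ e → u f = x' f) → Nat.card (D.Circle x) = Nat.card (D.Circle x') →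
        D.circle u (D.underIn e') ≠ D.circle u (D.underOut e') →
        D.circle x (D.underIn e') = D.circle x (D.underOut e') →
        D.circle u (D.underIn e) = D.circle u (D.underOut e) →
        D.circle x' (D.underIn e) ≠ D.circle x' (D.underOut e) → False := by
      intro e e' x x' hx hx' hxx h2 h3 h4 h5
      have h6 := D.card_circle_eq_add_one (fun f hf => (hx f hf).symm) h2 h3
      have h7 := D.card_circle_eq_add_one hx' h5 h4
      omega
    by_cases hB : D.circle w (D.underIn c') = D.circle w (D.underOut c') <;>
      by_cases hB' : D.circle w' (D.underIn c) = D.circle w' (D.underOut c)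
    · rw [D.edgeFactor_of_eq h hB, D.edgeFactor_of_eq h hB', sub_self]
      exact zero_mem _
    · exact (hcount hu hu' (by omega) (fun h => hcu.1 h hB) hB (hcu'.2 hB') hB').elim
    · exact (hcount hu' hu (by omega) (fun h => hcu'.1 h hB') hB' (hcu.2 hB) hB).elim
    · rw [D.edgeFactor_of_ne h hB, D.edgeFactor_of_ne h hB']
      have h2 : D.circle v (D.underIn c') = D.circle v (D.underIn c) := by
        rcases ((D.circle_eq_or_of_circle_eq (fun e he => (hw e he).symm) hA').resolve_left
          hB).1 with h2 | h2
        · exact hle h2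
        · rw [hle h2, hA]
      convert add_mem (D.sub_mem_stateIdeal h t h2)
        (D.sub_mem_stateIdeal h t (hA' ▸ hA ▸ h2)) using 1
      ring

theorem d_d (x : D.Chain h t) : D.d h t (D.d h t x) = 0 := by
  obtain ⟨p, rfl⟩ := D.toChain_surjective h t x
  funext v
  rw [d_toChain_eq, d_toChain]
  simp only [Finset.sum_mul, map_sum, Finset.smul_sum]
  rw [Finset.sum_sigma']
  have hmem : ∀ x : (_ : Fin D.n) × Fin D.n,
      x ∈ (Finset.univ.filter fun c => v c = true).sigma
        (fun c => Finset.univ.filter fun c' => Function.update v c false c' = true) →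
      x.1 ≠ x.2 ∧ v x.1 = true ∧ v x.2 = true := by
    rintro ⟨c, c'⟩ hx
    simp only [Finset.mem_sigma, Finset.mem_filter, Finset.mem_univ, true_and] at hx
    rcases eq_or_ne c' c with rfl | hcc
    · simp at hx
    · rw [Function.update_of_ne hcc] at hx
      exact ⟨hcc.symm, hx⟩
  refine Finset.sum_involution (fun x _ => ⟨x.2, x.1⟩) ?_ ?_ ?_ ?_
  · intro x hx
    obtain ⟨hcc, hc, hc'⟩ := hmem x hx
    have hterm : ∀ c c' : Fin D.n, D.cubeSign v c • D.toStateModule h t v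
        (D.cubeSign (Function.update v c false) c' •
          (p (Function.update (Function.update v c false) c' false) *
            D.edgeFactor h (Function.update v c false) c') * D.edgeFactor h v c) =
        (D.cubeSign v c * D.cubeSign (Function.update v c false) c') • D.toStateModule h t v
          (p (Function.update (Function.update v c false) c' false) *
            (D.edgeFactor h (Function.update v c false) c' * D.edgeFactor h v c)) := by
      intro c c'
      rw [smul_mul_assoc, map_zsmul, mul_assoc, smul_smul]
    rw [hterm, hterm, D.cubeSign_mul_cubeSign_update hcc hc hc',
      Function.update_comm hcc, neg_smul, neg_add_eq_zero, ← sub_eq_zero, ← smul_sub, ← map_sub,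
      ← mul_sub, (D.toStateModule_eq_zero_iff h t).2, smul_zero]
    exact Ideal.mul_mem_left _ _ (D.edgeFactor_mul_sub_mem h t hcc hc hc')
  · intro x hx _ heq
    exact (hmem x hx).1 (congrArg Sigma.fst heq).symm
  · intro x hx
    obtain ⟨hcc, hc, hc'⟩ := hmem x hx
    simp [hc', hcc, hc]
  · exact fun _ _ => rfl

/-- Half of the largest shifted `q`-degree in the resolution `v`, rounded down, so that no parity of the
`q`-degree has to be known. -/
noncomputable def halfDegree (v : D.State) : ℤ := (D.qDegree v 0 + 1) / 2

theorem le_qDegree_iff (v : D.State) (p : ℤ) (k : ℕ) :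
    2 * p - 1 ≤ D.qDegree v k ↔ (k : ℤ) ≤ D.halfDegree v - p := by
  have : D.qDegree v k = D.qDegree v 0 - 2 * k := by simp only [qDegree]; push_cast; ring
  rw [this, halfDegree]
  omega

theorem halfDegree_of_eq {v : D.State} {c : Fin D.n} (hc : v c = true)
    (hA : D.circle v (D.underIn c) = D.circle v (D.underOut c)) :
    D.halfDegree v = D.halfDegree (Function.update v c false) := by
  have hw : ∀ e, e ≠ c → Function.update v c false e = v e := fun e he =>
    Function.update_of_ne he _ _
  have h1 := D.card_circle_eq_add_one (fun e he => (hw e he).symm)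
    (fun h1 => (D.circle_under_eq_iff_ne hw (by simp [hc])).1 h1 hA) hA
  have h2 := D.card_filter_update v hc
  simp only [halfDegree, qDegree, h1, h2]
  push_cast
  congr 2
  ring

theorem halfDegree_of_ne {v : D.State} {c : Fin D.n} (hc : v c = true)
    (hA : D.circle v (D.underIn c) ≠ D.circle v (D.underOut c)) :
    D.halfDegree v = D.halfDegree (Function.update v c false) + 1 := by
  have hw : ∀ e, e ≠ c → Function.update v c false e = v e := fun e he =>
    Function.update_of_ne he _ _
  have h1 := D.card_circle_eq_add_one hw hA
    ((D.circle_under_eq_iff_ne hw (by simp [hc])).2 hA)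
  have h2 := D.card_filter_update v hc
  simp only [halfDegree, qDegree, h1, h2]
  push_cast
  omega

end KnotDiagram

/-! ### The Lee system as Rees algebra of the Bar-Natan system -/

/-- The coefficients of a polynomial, with value zero at negative exponents. -/
noncomputable def Polynomial.intCoeff {S : Type*} [CommRing S] (f : Polynomial S) (k : ℤ) : S :=
  if 0 ≤ k then f.coeff k.toNat else 0

namespace Polynomial

variable {S : Type*} [CommRing S]

theorem intCoeff_of_neg (f : Polynomial S) {k : ℤ} (hk : k < 0) : f.intCoeff k = 0 :=
  if_neg hk.not_ge

theorem intCoeff_natCast (f : Polynomial S) (k : ℕ) : f.intCoeff k = f.coeff k := by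
  simp [intCoeff]

theorem intCoeff_zero (k : ℤ) : (0 : Polynomial S).intCoeff k = 0 := by
  simp [intCoeff]

theorem intCoeff_add (f g : Polynomial S) (k : ℤ) :
    (f + g).intCoeff k = f.intCoeff k + g.intCoeff k := by
  unfold intCoeff
  split_ifs <;> simp

theorem intCoeff_mul_C (f : Polynomial S) (a : S) (k : ℤ) :
    (f * C a).intCoeff k = f.intCoeff k * a := by
  unfold intCoeff
  split_ifs <;> simp

theorem intCoeff_mul_X (f : Polynomial S) (k : ℤ) :
    (f * X).intCoeff k = f.intCoeff (k - 1) := by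
  unfold intCoeff
  rcases lt_trichotomy k 0 with h | rfl | h
  · rw [if_neg (by omega), if_neg (by omega)]
  · simp
  · rw [if_pos (by omega), if_pos (by omega), show k.toNat = (k - 1).toNat + 1 by omega,
      coeff_mul_X]

theorem intCoeff_C_mul_X_pow (a : S) (n : ℕ) (k : ℤ) :
    (C a * X ^ n).intCoeff k = if k = n then a else 0 := by
  unfold intCoeff
  rw [coeff_C_mul_X_pow]
  split_ifs <;> first | rfl | omega

end Polynomial

namespace GaussCode

open MvPolynomial

variable (D : GaussCode) (F : Type*) [Field F]

/-- The homogenization of the change of variables that turns the Lee system into the Bar-Natan system: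
a variable `x` of the Lee system is sent to `(y - 1/2) H` and `T` is sent to `(H / 2) ^ 2`. Here `H`
is the variable of the outer polynomial ring, and `y` belongs to the Bar-Natan system at `H = 1`. -/
noncomputable def reesHom : D.EdgeRing (Polynomial F) →+* Polynomial (D.EdgeRing F) :=
  eval₂Hom (Polynomial.eval₂RingHom (Polynomial.C.comp C)
    (Polynomial.C (C (2⁻¹ ^ 2)) * Polynomial.X ^ 2))
    fun e => Polynomial.C (X e - C 2⁻¹) * Polynomial.X

variable {F}

theorem reesHom_X (e : D.Edge) :
    D.reesHom F (X e) = Polynomial.C (X e - C 2⁻¹) * Polynomial.X := by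
  simp [reesHom]

theorem reesHom_C_X : D.reesHom F (C Polynomial.X) =
    Polynomial.C (C (2⁻¹ ^ 2)) * Polynomial.X ^ 2 := by
  simp [reesHom]

theorem reesHom_C_C (a : F) : D.reesHom F (C (Polynomial.C a)) = Polynomial.C (C a) := by
  simp [reesHom]

theorem totalDegree_coeff_reesHom_le (f : D.EdgeRing (Polynomial F)) (n : ℕ) :
    ((D.reesHom F f).coeff n).totalDegree ≤ n := by
  induction f using MvPolynomial.induction_on generalizing n with
  | C a =>
    induction a using Polynomial.induction_on' with
    | add p q hp hq =>
      rw [C_add, map_add, Polynomial.coeff_add]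
      exact (totalDegree_add _ _).trans (max_le hp hq)
    | monomial k c =>
      have h1 : D.reesHom F (C (Polynomial.monomial k c)) =
          Polynomial.C (C (c * (2⁻¹ ^ 2) ^ k)) * Polynomial.X ^ (2 * k) := by
        rw [← Polynomial.C_mul_X_pow_eq_monomial, C_mul, C_pow, map_mul, map_pow, reesHom_C_X,
          reesHom_C_C, mul_pow, pow_mul]
        simp only [C_mul, C_pow, Polynomial.C_mul, Polynomial.C_pow, mul_assoc]
      rw [h1, Polynomial.coeff_C_mul_X_pow]
      split_ifs
      · rw [totalDegree_C]; exact Nat.zero_le _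
      · simp
  | add p q hp hq =>
    rw [map_add, Polynomial.coeff_add]
    exact (totalDegree_add _ _).trans (max_le (hp n) (hq n))
  | mul_X p e hp =>
    rw [map_mul, reesHom_X, ← mul_assoc]
    cases n with
    | zero => simp
    | succ n =>
      rw [Polynomial.coeff_mul_X, Polynomial.coeff_mul_C]
      refine (totalDegree_mul _ _).trans (add_le_add (hp n) ?_)
      refine (totalDegree_sub _ _).trans ?_
      simp

theorem joined_sub_mem {R : Type*} [CommRing R] (h t : R) {v : D.State} {e f : D.Edge}
    (hef : D.Joined v e f) : (X e - X f : D.EdgeRing R) ∈ D.stateIdeal h t v :=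
  Ideal.subset_span (Or.inl ⟨e, f, hef, rfl⟩)

theorem quadratic_mem {R : Type*} [CommRing R] (h t : R) (v : D.State) (e : D.Edge) :
    (X e ^ 2 - C h * X e - C t : D.EdgeRing R) ∈ D.stateIdeal h t v :=
  Ideal.subset_span (Or.inr ⟨e, rfl⟩)

theorem stateIdeal_le_iff {R : Type*} [CommRing R] (h t : R) (v : D.State)
    (I : Ideal (D.EdgeRing R)) : D.stateIdeal h t v ≤ I ↔
      (∀ e f, D.Joined v e f → X e - X f ∈ I) ∧ ∀ e, X e ^ 2 - C h * X e - C t ∈ I := by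
  constructor
  · exact fun H => ⟨fun e f hef => H (D.joined_sub_mem h t hef), fun e => H (D.quadratic_mem h t v e)⟩
  · rintro ⟨h1, h2⟩
    refine Ideal.span_le.2 ?_
    rintro p (⟨e, f, hef, rfl⟩ | ⟨e, rfl⟩)
    exacts [h1 e f hef, h2 e]

theorem two_mul_C_inv_two (h2 : (2 : F) ≠ 0) : 2 * (C 2⁻¹ : D.EdgeRing F) = 1 := by
  rw [show (2 : D.EdgeRing F) = C 2 from (map_ofNat C 2).symm, ← C_mul, mul_inv_cancel₀ h2, C_1]

theorem coeff_reesHom_mem (h2 : (2 : F) ≠ 0) {v : D.State} {f : D.EdgeRing (Polynomial F)}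
    (hf : f ∈ D.stateIdeal 0 Polynomial.X v) (n : ℕ) :
    (D.reesHom F f).coeff n ∈ D.stateIdeal 1 0 v := by
  revert n
  rw [← Ideal.mem_map_C_iff]
  suffices h : D.stateIdeal 0 Polynomial.X v ≤
      (Ideal.map Polynomial.C (D.stateIdeal (1 : F) 0 v)).comap (D.reesHom F) from h hf
  have h3 := D.two_mul_C_inv_two h2
  refine (D.stateIdeal_le_iff _ _ _ _).2 ⟨fun e f hef => ?_, fun e => ?_⟩
  · rw [Ideal.mem_comap, map_sub, reesHom_X, reesHom_X, ← sub_mul, ← Polynomial.C_sub]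
    refine Ideal.mul_mem_right _ _ (Ideal.mem_map_of_mem _ ?_)
    convert D.joined_sub_mem (1 : F) 0 hef using 1
    ring
  · have h4 : D.reesHom F (X e ^ 2 - C 0 * X e - C Polynomial.X) =
        Polynomial.C (X e ^ 2 - C 1 * X e - C 0) * Polynomial.X ^ 2 := by
      rw [C_0, zero_mul, sub_zero, map_sub, map_pow, reesHom_X, reesHom_C_X, mul_pow, ← sub_mul,
        ← Polynomial.C_pow, ← Polynomial.C_sub]
      congr 2
      rw [C_pow, C_1, C_0]
      linear_combination -X e * h3
    rw [Ideal.mem_comap, h4]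
    exact Ideal.mul_mem_right _ _ (Ideal.mem_map_of_mem _ (D.quadratic_mem 1 0 v e))

theorem intCoeff_reesHom_mem (h2 : (2 : F) ≠ 0) {v : D.State} {f : D.EdgeRing (Polynomial F)}
    (hf : f ∈ D.stateIdeal 0 Polynomial.X v) (k : ℤ) :
    (D.reesHom F f).intCoeff k ∈ D.stateIdeal 1 0 v := by
  unfold Polynomial.intCoeff
  split_ifs
  exacts [D.coeff_reesHom_mem h2 hf _, zero_mem _]

theorem reesHom_edgeFactor_of_ne (h2 : (2 : F) ≠ 0) {v : D.State} {c : Fin D.n}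
    (hc : D.circle v (D.underIn c) ≠ D.circle v (D.underOut c)) :
    D.reesHom F (D.edgeFactor 0 v c) = Polynomial.C (D.edgeFactor 1 v c) * Polynomial.X := by
  rw [D.edgeFactor_of_ne _ hc, D.edgeFactor_of_ne _ hc, C_0, sub_zero, map_add, reesHom_X, reesHom_X,
    ← add_mul, ← Polynomial.C_add]
  congr 2
  rw [C_1]
  linear_combination -D.two_mul_C_inv_two h2

/-- The relations of the Lee system are detected by the labellings of the circles by `H / 2` and
`-H / 2` that are `H / 2` at the base point. The combinatorial Nullstellensatz over `𝔽[H]` writes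
a polynomial that vanishes at all of these as a combination of relations, and substituting `2 x₀`
for `H` transports the combination back. -/
theorem mem_stateIdeal_of_eval_eq_zero (h2 : (2 : F) ≠ 0) {v : D.State}
    {f : D.EdgeRing (Polynomial F)}
    (hf : ∀ s : D.Circle v → Polynomial F,
      s (D.circle v 0) = Polynomial.C 2⁻¹ * Polynomial.X →
      (∀ c, s c = Polynomial.C 2⁻¹ * Polynomial.X ∨ s c = -(Polynomial.C 2⁻¹ * Polynomial.X)) →
      eval₂ (Polynomial.eval₂RingHom Polynomial.C ((Polynomial.C 2⁻¹ * Polynomial.X) ^ 2))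
        (fun e => s (D.circle v e)) f = 0) : f ∈ D.stateIdeal 0 Polynomial.X v := by
  classical
  have : Finite (D.Circle v) := Quot.finite _
  set a : Polynomial F := Polynomial.C 2⁻¹ * Polynomial.X with ha
  have hane : a ≠ -a := by
    have h3 : a - -a = Polynomial.X := by
      rw [sub_neg_eq_add, ← two_mul, ha, ← mul_assoc, show (2 : Polynomial F) = Polynomial.C 2 from
        (map_ofNat Polynomial.C 2).symm, ← Polynomial.C_mul, mul_inv_cancel₀ h2, Polynomial.C_1,
        one_mul]
    exact fun h => Polynomial.X_ne_zero (h3.symm.trans (sub_eq_zero.2 h))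
  let θ : D.EdgeRing (Polynomial F) →+* MvPolynomial (D.Circle v) (Polynomial F) :=
    eval₂Hom (C.comp (Polynomial.eval₂RingHom Polynomial.C (a ^ 2))) fun e => X (D.circle v e)
  let S : D.Circle v → Finset (Polynomial F) := fun c => if c = D.circle v 0 then {a} else {a, -a}
  obtain ⟨g, -, hg⟩ := combinatorial_nullstellensatz_exists_linearCombination S
    (fun c => by simp only [S]; split_ifs <;> simp) (θ f) (fun s hs => by
      rw [← hf s (by simpa [S] using hs (D.circle v 0)) fun c => ?_]
      · have hcomp : (eval s).comp θ = eval₂Hom (Polynomial.eval₂RingHom Polynomial.C (a ^ 2))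
            fun e => s (D.circle v e) := by
          refine MvPolynomial.ringHom_ext (fun r => ?_) fun e => ?_
          · simp [θ]
          · simp [θ]
        exact congrArg (fun φ => φ f) hcomp
      · have hc := hs c
        simp only [S] at hc
        split_ifs at hc
        · exact Or.inl (by simpa using hc)
        · simpa using hc)
  -- go back: send `H` to twice the variable of the base point
  let I := D.stateIdeal (0 : Polynomial F) Polynomial.X v
  let κ : MvPolynomial (D.Circle v) (Polynomial F) →+* D.EdgeRing (Polynomial F) ⧸ I :=
    eval₂Hom (Polynomial.eval₂RingHom ((Ideal.Quotient.mk I).comp (C.comp Polynomial.C))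
      (Ideal.Quotient.mk I (2 * X 0)))
      (Quot.lift (fun e => Ideal.Quotient.mk I (X e)) fun e f hef =>
        Ideal.Quotient.eq.2 (D.joined_sub_mem _ _ hef))
  have hκX : ∀ e, κ (X (D.circle v e)) = Ideal.Quotient.mk I (X e) := fun e => by
    simp [κ, circle]
  have hκa : κ (C a) = Ideal.Quotient.mk I (X 0) := by
    have h3 : (C (Polynomial.C 2⁻¹) : D.EdgeRing (Polynomial F)) * 2 = 1 := by
      rw [show (2 : D.EdgeRing (Polynomial F)) = C (Polynomial.C 2) by
          rw [map_ofNat Polynomial.C 2, map_ofNat C 2], ← C_mul,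
        ← Polynomial.C_mul, inv_mul_cancel₀ h2, Polynomial.C_1, C_1]
    simp only [κ, ha, eval₂Hom_C, map_mul, Polynomial.coe_eval₂RingHom, Polynomial.eval₂_C,
      Polynomial.eval₂_X, RingHom.comp_apply]
    rw [← mul_assoc, ← map_mul, ← map_mul, h3, one_mul]
  have hsq : ∀ e, Ideal.Quotient.mk I (X e) ^ 2 = Ideal.Quotient.mk I (C Polynomial.X) := by
    intro e
    rw [← map_pow, Ideal.Quotient.eq]
    simpa using D.quadratic_mem (0 : Polynomial F) Polynomial.X v e
  have hκθ : κ.comp θ = Ideal.Quotient.mk I := by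
    refine MvPolynomial.ringHom_ext (fun r => ?_) fun e => ?_
    · have h4 : (κ.comp C).comp (Polynomial.eval₂RingHom Polynomial.C (a ^ 2)) =
          (Ideal.Quotient.mk I).comp C := by
        refine Polynomial.ringHom_ext (fun r => ?_) ?_
        · simp [κ]
        · simp only [RingHom.comp_apply, Polynomial.coe_eval₂RingHom, Polynomial.eval₂_X]
          rw [C_pow, map_pow, hκa, hsq]
      simpa [θ] using congrArg (fun φ => φ r) h4
    · simp only [RingHom.comp_apply]
      rw [show θ (X e) = X (D.circle v e) by simp [θ], hκX]
  rw [← Ideal.Quotient.eq_zero_iff_mem]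
  change Ideal.Quotient.mk I f = 0
  rw [← hκθ, RingHom.comp_apply, hg, Finsupp.linearCombination_apply, Finsupp.sum, map_sum]
  refine Finset.sum_eq_zero fun c _ => ?_
  rw [smul_eq_mul, map_mul]
  refine mul_eq_zero_of_right _ ?_
  obtain ⟨e, rfl⟩ : ∃ e, D.circle v e = c := Quot.exists_rep c
  by_cases hc : D.circle v e = D.circle v 0
  · simp only [S, if_pos hc, Finset.prod_singleton]
    rw [hc, map_sub, hκX, hκa, sub_self]
  · simp only [S, if_neg hc, Finset.prod_pair hane]
    rw [C_neg, map_mul, map_sub, map_sub, map_neg, hκX, hκa]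
    linear_combination hsq e - hsq 0

/-- Injectivity of the Rees map in one resolution. A labelling `± H / 2` of the circles factors through
`reesHom` and the evaluation of the Bar-Natan system at `1` or `0`, respectively. -/
theorem mem_stateIdeal_of_coeff_reesHom_mem (h2 : (2 : F) ≠ 0) {v : D.State}
    {f : D.EdgeRing (Polynomial F)}
    (hf : ∀ n, X 0 * (D.reesHom F f).coeff n ∈ D.stateIdeal 1 0 v) :
    f ∈ D.stateIdeal 0 Polynomial.X v := by
  classical
  refine D.mem_stateIdeal_of_eval_eq_zero h2 fun s hs0 hs => ?_
  set a : Polynomial F := Polynomial.C 2⁻¹ * Polynomial.X with ha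
  let δ : D.Edge → F := fun e => if s (D.circle v e) = a then 1 else 0
  have hδ : D.stateIdeal (1 : F) 0 v ≤ RingHom.ker (eval δ) := by
    refine (D.stateIdeal_le_iff _ _ _ _).2 ⟨fun e f hef => ?_, fun e => ?_⟩
    · have : D.circle v e = D.circle v f := Quot.sound hef
      simp [RingHom.mem_ker, δ, this]
    · by_cases h : s (D.circle v e) = a <;> simp [RingHom.mem_ker, δ, h]
  have h3 : (1 - 2⁻¹ : F) = 2⁻¹ := by
    rw [sub_eq_iff_eq_add, ← two_mul, mul_inv_cancel₀ h2]
  have hcomp : (Polynomial.mapRingHom (eval δ)).comp (D.reesHom F) =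
      eval₂Hom (Polynomial.eval₂RingHom Polynomial.C (a ^ 2)) fun e => s (D.circle v e) := by
    refine MvPolynomial.ringHom_ext (fun r => ?_) fun e => ?_
    · have h4 : ((Polynomial.mapRingHom (eval δ)).comp (D.reesHom F)).comp C =
          Polynomial.eval₂RingHom Polynomial.C (a ^ 2) := by
        refine Polynomial.ringHom_ext (fun r => ?_) ?_
        · simp [reesHom_C_C]
        · simp only [RingHom.comp_apply, reesHom_C_X]
          simp [ha, mul_pow, -inv_pow]
      simpa using congrArg (fun φ => φ r) h4
    · simp only [RingHom.comp_apply, reesHom_X]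
      rw [Polynomial.coe_mapRingHom, Polynomial.map_mul, Polynomial.map_C, Polynomial.map_X, map_sub,
        eval_X, eval_C, eval₂Hom_X']
      by_cases h : s (D.circle v e) = a
      · rw [show δ e = 1 from if_pos h, h3, h]
      · rw [show δ e = 0 from if_neg h, (hs (D.circle v e)).resolve_left h, zero_sub, Polynomial.C_neg,
          neg_mul]
  change eval₂Hom _ _ f = 0
  rw [← hcomp]
  ext n
  have h5 : eval δ (X 0 * (D.reesHom F f).coeff n) = 0 := hδ (hf n)
  rw [map_mul, eval_X, show δ 0 = 1 from if_pos hs0, one_mul] at h5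
  simpa using h5

end GaussCode

/-! ### The Rees map and the filtered reduced complex -/

namespace GaussCode

open MvPolynomial

variable (D : GaussCode) {F : Type*} [Field F]

theorem toStateModule_mem_qFiltrationAt {R : Type*} [CommRing R] (h t : R) {v : D.State} {j : ℤ}
    {p : D.EdgeRing R} (hp : ∀ m ∈ p.support, j ≤ D.qDegree v m.degree) :
    D.toStateModule h t v p ∈ D.qFiltrationAt h t v j := by
  rw [p.as_sum, map_sum]
  refine sum_mem fun m hm => ?_
  have h1 : monomial m (p.coeff m) = p.coeff m • (monomial m 1 : D.EdgeRing R) := by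
    rw [smul_monomial, smul_eq_mul, mul_one]
  rw [h1, LinearMap.map_smul_of_tower]
  exact Submodule.smul_mem _ _ (Submodule.subset_span ⟨m, hp m hm, rfl⟩)

theorem qFiltrationAt_antitone {R : Type*} [CommRing R] (h t : R) (v : D.State) :
    Antitone (D.qFiltrationAt h t v) := fun _ _ hij =>
  Submodule.span_mono fun _ ⟨m, hm, hy⟩ => ⟨m, hij.trans hm, hy⟩

theorem reducedFiltration_antitone {R : Type*} [CommRing R] (h t : R) :
    Antitone (D.reducedFiltration h t) := fun _ _ hij =>
  inf_le_inf_left _ <| Submodule.pi_mono fun v _ => D.qFiltrationAt_antitone h t v (by omega)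

theorem baseX_idempotent (v : D.State) :
    (X 0 * X 0 - X 0 : D.EdgeRing F) ∈ D.stateIdeal 1 0 v := by
  convert D.quadratic_mem (1 : F) 0 v 0 using 1
  rw [C_1, C_0]
  ring

/-- In the Bar-Natan system at `H = 1` the variables are idempotent, so that every element has
a representative of degree at most the number of edges. -/
theorem mem_qFiltrationAt_of_le {v : D.State} {j : ℤ}
    (hj : ∀ k ≤ 2 * D.n + 1, j ≤ D.qDegree v k) (y : D.StateModule (1 : F) 0 v) :
    y ∈ D.qFiltrationAt (1 : F) 0 v j := by
  obtain ⟨p, rfl⟩ := Submodule.mkQ_surjective (D.stateIdeal (1 : F) 0 v) y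
  change D.toStateModule 1 0 v p ∈ _
  rw [p.as_sum, map_sum]
  refine sum_mem fun m _ => ?_
  let m' : D.Edge →₀ ℕ := Finsupp.equivFunOnFinite.symm fun e => min (m e) 1
  have h1 : D.toStateModule (1 : F) 0 v (monomial m (p.coeff m)) =
      D.toStateModule (1 : F) 0 v (monomial m' (p.coeff m)) := by
    rw [← sub_eq_zero, ← map_sub, toStateModule_eq_zero_iff, ← Ideal.Quotient.eq]
    rw [monomial_eq, monomial_eq, Finsupp.prod_fintype _ _ fun _ => pow_zero _,
      Finsupp.prod_fintype _ _ fun _ => pow_zero _, map_mul, map_mul, map_prod, map_prod]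
    congr 1
    refine Finset.prod_congr rfl fun e _ => ?_
    have h2 : IsIdempotentElem (Ideal.Quotient.mk (D.stateIdeal (1 : F) 0 v) (X e)) := by
      rw [IsIdempotentElem, ← map_mul, Ideal.Quotient.eq]
      convert D.quadratic_mem (1 : F) 0 v e using 1
      rw [C_1, C_0]
      ring
    rw [map_pow, map_pow, show m' e = min (m e) 1 from rfl]
    rcases Nat.eq_zero_or_pos (m e) with h3 | h3
    · rw [h3]; rfl
    · rw [Nat.min_eq_right h3, pow_one, h2.pow_eq h3.ne']
  rw [h1]
  refine D.toStateModule_mem_qFiltrationAt _ _ fun m'' hm'' => ?_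
  rw [Finset.mem_singleton.1 (support_monomial_subset hm'')]
  refine hj _ ?_
  rw [Finsupp.degree_eq_sum]
  calc ∑ e, m' e ≤ ∑ _e : D.Edge, 1 := Finset.sum_le_sum fun e _ => min_le_right _ _
    _ = 2 * D.n + 1 := by simp

/-- The substitution of zero for the variables on the circle through the base point. -/
noncomputable def killBase (v : D.State) : D.EdgeRing F →ₐ[F] D.EdgeRing F :=
  open Classical in aeval fun e => if D.circle v e = D.circle v 0 then 0 else X e

theorem killBase_mem {v : D.State} {p : D.EdgeRing F} (hp : p ∈ D.stateIdeal 1 0 v) :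
    D.killBase v p ∈ D.stateIdeal 1 0 v := by
  suffices h : D.stateIdeal (1 : F) 0 v ≤
      (D.stateIdeal 1 0 v).comap (D.killBase (F := F) v).toRingHom from h hp
  refine (D.stateIdeal_le_iff _ _ _ _).2 ⟨fun e f hef => ?_, fun e => ?_⟩
  · have h1 : D.circle v e = D.circle v f := Quot.sound hef
    by_cases h : D.circle v f = D.circle v 0
    · simp [Ideal.mem_comap, killBase, h1, h]
    · simpa [Ideal.mem_comap, killBase, h1, h] using D.joined_sub_mem (1 : F) 0 hef
  · by_cases h : D.circle v e = D.circle v 0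
    · simp [Ideal.mem_comap, killBase, h]
    · simpa [Ideal.mem_comap, killBase, h] using D.quadratic_mem (1 : F) 0 v e

/-- Modulo the relations, a monomial is the base point variable times a monomial of smaller degree,
unless it has no variable on the circle through the base point. -/
theorem exists_sub_killBase_sub_mem (v : D.State) (m : D.Edge →₀ ℕ) :
    ∃ b : D.EdgeRing F, (b = 0 ∨ ∃ m' : D.Edge →₀ ℕ, m'.degree + 1 = m.degree ∧ b = monomial m' 1) ∧
      monomial m 1 - D.killBase v (monomial m 1) - X 0 * b ∈ D.stateIdeal 1 0 v := by
  classical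
  by_cases hm : ∃ e, m e ≠ 0 ∧ D.circle v e = D.circle v 0
  · obtain ⟨e, he, hbase⟩ := hm
    have h1 : m - Finsupp.single e 1 + Finsupp.single e 1 = m :=
      tsub_add_cancel_of_le (Finsupp.single_le_iff.2 (Nat.one_le_iff_ne_zero.2 he))
    have h2 : (monomial m 1 : D.EdgeRing F) = monomial (m - Finsupp.single e 1) 1 * X e := by
      rw [X, monomial_mul, h1, one_mul]
    refine ⟨monomial (m - Finsupp.single e 1) 1, Or.inr ⟨_, ?_, rfl⟩, ?_⟩
    · conv_rhs => rw [← h1]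
      simp
    · rw [h2, map_mul, show D.killBase v (X e : D.EdgeRing F) = 0 by simp [killBase, hbase]]
      convert Ideal.mul_mem_left _ (monomial (m - Finsupp.single e 1) 1)
        (D.sub_mem_stateIdeal (1 : F) 0 hbase) using 1
      ring
  · push Not at hm
    refine ⟨0, Or.inl rfl, ?_⟩
    have h1 : D.killBase v (monomial m 1 : D.EdgeRing F) = monomial m 1 := by
      rw [monomial_eq, map_mul, Finsupp.prod, map_prod, C_1, map_one]
      congr 1
      refine Finset.prod_congr rfl fun e he => ?_
      simp [killBase, hm e (Finsupp.mem_support_iff.1 he)]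
    simp [h1]

/-- The filtration of the reduced complex comes, with a shift by one, from the filtration of the
unreduced complex: an element of `X · C` of degree at most `k` is `X` times an element of degree less
than `k`. Substitution of zero for the base point variable shows that the part of a representative
without this variable is a relation. -/
theorem mem_span_of_mem_qFiltrationAt {v : D.State} {j : ℤ} {y : D.StateModule (1 : F) 0 v}
    (hy : y ∈ D.qFiltrationAt (1 : F) 0 v j) (hbase : (X 0 : D.EdgeRing F) • y = y) :
    y ∈ Submodule.span F {y | ∃ m : D.Edge →₀ ℕ, j ≤ D.qDegree v (m.degree + 1) ∧
      y = D.toStateModule (1 : F) 0 v (X 0 * monomial m 1)} := by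
  set V := Submodule.span F {y | ∃ m : D.Edge →₀ ℕ, j ≤ D.qDegree v (m.degree + 1) ∧
      y = D.toStateModule (1 : F) 0 v (X 0 * monomial m 1)}
  have h1 : ∃ p : D.EdgeRing F, y = D.toStateModule (1 : F) 0 v p ∧
      D.toStateModule (1 : F) 0 v (p - D.killBase v p) ∈ V := by
    clear hbase
    induction hy using Submodule.span_induction with
    | mem y hy =>
      obtain ⟨m, hm, rfl⟩ := hy
      refine ⟨_, rfl, ?_⟩
      obtain ⟨b, hb, hmb⟩ := D.exists_sub_killBase_sub_mem (F := F) v m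
      rw [← D.toStateModule_eq_zero_iff, map_sub, sub_eq_zero] at hmb
      rw [hmb]
      rcases hb with rfl | ⟨m', hm', rfl⟩
      · simp
      · exact Submodule.subset_span ⟨m', hm' ▸ hm, rfl⟩
    | zero => exact ⟨0, by simp, by simp⟩
    | add x y _ _ hx hy =>
      obtain ⟨p, rfl, hp⟩ := hx
      obtain ⟨q, rfl, hq⟩ := hy
      refine ⟨p + q, (map_add _ _ _).symm, ?_⟩
      rw [map_add, add_sub_add_comm, map_add]
      exact add_mem hp hq
    | smul a x _ hx =>
      obtain ⟨p, rfl, hp⟩ := hx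
      refine ⟨a • p, (LinearMap.map_smul_of_tower _ _ _).symm, ?_⟩
      rw [map_smul, ← smul_sub, LinearMap.map_smul_of_tower]
      exact Submodule.smul_mem _ _ hp
  obtain ⟨p, rfl, hp⟩ := h1
  rw [map_sub] at hp
  have h2 : D.toStateModule (1 : F) 0 v (D.killBase v p) = 0 := by
    rw [toStateModule_eq_zero_iff]
    have h3 : X 0 * p - p ∈ D.stateIdeal (1 : F) 0 v := by
      rw [← D.toStateModule_eq_zero_iff, map_sub, sub_eq_zero, ← smul_eq_mul, map_smul]
      exact hbase
    have h4 := neg_mem (D.killBase_mem h3)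
    rw [map_sub, map_mul, show D.killBase v (X 0 : D.EdgeRing F) = 0 by simp [killBase], zero_mul,
      zero_sub, neg_neg] at h4
    exact h4
  rwa [h2, sub_zero] at hp

theorem baseX_mul_mem {v : D.State} {p : D.EdgeRing F}
    (hp : p ∈ D.stateIdeal 1 0 v ⊔ Ideal.span {X 0 - 1}) : X 0 * p ∈ D.stateIdeal 1 0 v := by
  obtain ⟨q, hq, r, hr, rfl⟩ := Submodule.mem_sup.1 hp
  obtain ⟨g, rfl⟩ := Ideal.mem_span_singleton'.1 hr
  rw [mul_add]
  refine add_mem (Ideal.mul_mem_left _ _ hq) ?_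
  convert Ideal.mul_mem_left _ g (D.baseX_idempotent v) using 1
  ring

/-- Homogenization: the preimage of a monomial `m` in the `k`-th power of `H` is the product of the
elements `x + x₀`, multiplied with a power of `2 x₀`. -/
theorem exists_reesHom_eq_monomial (h2 : (2 : F) ≠ 0) (v : D.State) (m : D.Edge →₀ ℕ) (r : ℕ) :
    ∃ f : D.EdgeRing (Polynomial F), ∃ p : D.EdgeRing F,
      D.reesHom F f = Polynomial.C p * Polynomial.X ^ (m.degree + r) ∧
      X 0 * p - X 0 * monomial m 1 ∈ D.stateIdeal 1 0 v := by
  refine ⟨(∏ e, (X e + X 0) ^ m e) * (X 0 + X 0) ^ r,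
    (∏ e, (X e + X 0 - 1) ^ m e) * (X 0 + X 0 - 1) ^ r, ?_, ?_⟩
  · have h3 : ∀ e, D.reesHom F (X e + X 0) = Polynomial.C (X e + X 0 - 1) * Polynomial.X := by
      intro e
      rw [map_add, reesHom_X, reesHom_X, ← add_mul, ← Polynomial.C_add]
      congr 2
      linear_combination -D.two_mul_C_inv_two h2
    rw [map_mul, map_pow, map_prod, Finsupp.degree_eq_sum, pow_add, ← Finset.prod_pow_eq_pow_sum]
    simp only [map_pow, h3, mul_pow, Finset.prod_mul_distrib, Polynomial.C_mul, map_prod]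
    ring
  · rw [← mul_sub]
    refine D.baseX_mul_mem ?_
    set I := D.stateIdeal (1 : F) 0 v ⊔ Ideal.span {X 0 - 1}
    have h3 : Ideal.Quotient.mk I (X 0) = 1 := by
      rw [← map_one (Ideal.Quotient.mk I), Ideal.Quotient.eq]
      exact Ideal.mem_sup_right (Ideal.mem_span_singleton_self _)
    rw [← Ideal.Quotient.eq, monomial_eq, Finsupp.prod_fintype _ _ fun _ => pow_zero _]
    simp [h3]

/-- The Rees map in the resolution `v`: the coefficient of `H ^ k`, as an element of the reduced
complex at `H = 1`. -/
noncomputable def reesState (h2 : (2 : F) ≠ 0) (v : D.State) (k : ℤ) :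
    D.StateModule (0 : Polynomial F) Polynomial.X v →+ D.StateModule (1 : F) 0 v :=
  QuotientAddGroup.lift (D.stateIdeal (0 : Polynomial F) Polynomial.X v).toAddSubgroup
    { toFun := fun f => D.toStateModule 1 0 v (X 0 * (D.reesHom F f).intCoeff k)
      map_zero' := by rw [map_zero, Polynomial.intCoeff_zero, mul_zero, map_zero]
      map_add' := fun f g => by rw [map_add, Polynomial.intCoeff_add, mul_add, map_add] }
    fun f hf => (D.toStateModule_eq_zero_iff 1 0).2
      (Ideal.mul_mem_left _ _ (D.intCoeff_reesHom_mem h2 hf k))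

theorem reesState_toStateModule (h2 : (2 : F) ≠ 0) (v : D.State) (k : ℤ)
    (f : D.EdgeRing (Polynomial F)) :
    D.reesState h2 v k (D.toStateModule 0 Polynomial.X v f) =
      D.toStateModule 1 0 v (X 0 * (D.reesHom F f).intCoeff k) := rfl

theorem exists_reesState_eq (h2 : (2 : F) ≠ 0) {v : D.State} {k : ℤ}
    {y : D.StateModule (1 : F) 0 v}
    (hy : y ∈ Submodule.span F {y | ∃ m : D.Edge →₀ ℕ, (m.degree : ℤ) ≤ k ∧
      y = D.toStateModule (1 : F) 0 v (X 0 * monomial m 1)}) :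
    ∃ a, ∀ l, D.reesState h2 v l a = if l = k then y else 0 := by
  induction hy using Submodule.span_induction with
  | mem y hy =>
    obtain ⟨m, hm, rfl⟩ := hy
    obtain ⟨f, p, hf, hp⟩ := D.exists_reesHom_eq_monomial h2 v m (k - m.degree).toNat
    refine ⟨D.toStateModule 0 Polynomial.X v f, fun l => ?_⟩
    rw [reesState_toStateModule, hf, Polynomial.intCoeff_C_mul_X_pow,
      show ((m.degree + (k - m.degree).toNat : ℕ) : ℤ) = k by omega]
    split_ifs
    · rw [← sub_eq_zero, ← map_sub, toStateModule_eq_zero_iff]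
      exact hp
    · rw [mul_zero, map_zero]
  | zero => exact ⟨0, fun l => by simp⟩
  | add x y _ _ hx hy =>
    obtain ⟨a, ha⟩ := hx
    obtain ⟨b, hb⟩ := hy
    refine ⟨a + b, fun l => ?_⟩
    rw [map_add, ha, hb]
    split_ifs <;> simp
  | smul c x _ hx =>
    obtain ⟨a, ha⟩ := hx
    obtain ⟨f, rfl⟩ := Submodule.mkQ_surjective (D.stateIdeal (0 : Polynomial F) Polynomial.X v) a
    refine ⟨D.toStateModule 0 Polynomial.X v (f * C (Polynomial.C c)), fun l => ?_⟩
    have h3 := ha l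
    change D.reesState h2 v l (D.toStateModule 0 Polynomial.X v f) = _ at h3
    rw [reesState_toStateModule] at h3
    rw [reesState_toStateModule, map_mul (D.reesHom F), reesHom_C_C, Polynomial.intCoeff_mul_C, ← mul_assoc,
      mul_comm _ (C c), ← smul_eq_C_mul, LinearMap.map_smul_of_tower, h3]
    split_ifs <;> simp

theorem eq_zero_of_reesState_eq_zero (h2 : (2 : F) ≠ 0) {v : D.State}
    {a : D.StateModule (0 : Polynomial F) Polynomial.X v}
    (ha : ∀ l, D.reesState h2 v l a = 0) : a = 0 := by
  obtain ⟨f, rfl⟩ := Submodule.mkQ_surjective (D.stateIdeal (0 : Polynomial F) Polynomial.X v) a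
  refine (D.toStateModule_eq_zero_iff 0 Polynomial.X).2
    (D.mem_stateIdeal_of_coeff_reesHom_mem h2 fun n => ?_)
  have h3 := ha n
  change D.reesState h2 v n (D.toStateModule 0 Polynomial.X v f) = _ at h3
  rwa [reesState_toStateModule, toStateModule_eq_zero_iff, Polynomial.intCoeff_natCast] at h3

end GaussCode

namespace KnotDiagram

open GaussCode MvPolynomial

variable (D : KnotDiagram) {F : Type*} [Field F]

theorem reducedFiltration_eq_bot : ∃ P : ℤ, ∀ p, P ≤ p → D.reducedFiltration (1 : F) 0 p = ⊥ := by
  obtain ⟨P, hP⟩ := (Set.finite_range D.halfDegree).bddAbove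
  refine ⟨P + 1, fun p hp => ?_⟩
  rw [Submodule.eq_bot_iff]
  rintro x ⟨-, hx⟩
  funext v
  have h1 := hx v (Set.mem_univ v)
  have h2 : D.qFiltrationAt (1 : F) 0 v (2 * p - 1) ≤ ⊥ := by
    refine Submodule.span_le.2 ?_
    rintro y ⟨m, hm, -⟩
    rw [D.le_qDegree_iff] at hm
    have := hP ⟨v, rfl⟩
    omega
  exact h2 h1

theorem exists_reducedFiltration_le :
    ∃ Q : ℤ, ∀ p, D.reducedFiltration (1 : F) 0 p ≤ D.reducedFiltration (1 : F) 0 Q := by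
  obtain ⟨Q, hQ⟩ := (Set.finite_range D.halfDegree).bddBelow
  refine ⟨Q - (2 * D.n + 1), fun p => inf_le_inf_left _ fun x _ v _ =>
    D.mem_qFiltrationAt_of_le (fun k hk => ?_) _⟩
  rw [D.le_qDegree_iff]
  have := hQ ⟨v, rfl⟩
  omega

/-- The Rees map from the Lee complex to the families of elements of the reduced Bar-Natan complex at
`H = 1`, indexed by the filtration degree. -/
noncomputable def reesMap (h2 : (2 : F) ≠ 0) :
    D.Chain (0 : Polynomial F) Polynomial.X →+ (ℤ → D.Chain (1 : F) 0) where
  toFun a q v := D.reesState h2 v (D.halfDegree v - 1 - q) (a v)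
  map_zero' := by funext q v; exact map_zero _
  map_add' a b := by funext q v; exact map_add _ _ _

theorem reesMap_toChain (h2 : (2 : F) ≠ 0) (p : D.State → D.EdgeRing (Polynomial F)) (q : ℤ) :
    D.reesMap h2 (D.toChain 0 Polynomial.X p) q = D.toChain 1 0 fun v =>
      X 0 * (D.reesHom F (p v)).intCoeff (D.halfDegree v - 1 - q) := rfl

theorem reesMap_d (h2 : (2 : F) ≠ 0) (a : D.Chain (0 : Polynomial F) Polynomial.X) (q : ℤ) :
    D.reesMap h2 (D.d 0 Polynomial.X a) q = D.d 1 0 (D.reesMap h2 a q) := by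
  obtain ⟨p, rfl⟩ := D.toChain_surjective 0 Polynomial.X a
  funext v
  rw [reesMap_toChain, d_toChain]
  change D.reesState h2 v _ (D.d 0 Polynomial.X (D.toChain 0 Polynomial.X p) v) = _
  rw [d_toChain, map_sum]
  refine Finset.sum_congr rfl fun c hc => ?_
  have hc : v c = true := by simpa using hc
  rw [map_zsmul, reesState_toStateModule, map_mul (D.reesHom F)]
  congr 2
  by_cases hA : D.circle v (D.underIn c) = D.circle v (D.underOut c)
  · rw [D.edgeFactor_of_eq _ hA, D.edgeFactor_of_eq _ hA, map_one, mul_one, mul_one,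
      D.halfDegree_of_eq hc hA]
  · rw [D.reesHom_edgeFactor_of_ne h2 hA, ← mul_assoc, Polynomial.intCoeff_mul_X,
      Polynomial.intCoeff_mul_C, mul_assoc, D.halfDegree_of_ne hc hA]
    congr 3
    ring_nf

theorem reesMap_baseX_smul (h2 : (2 : F) ≠ 0) (a : D.Chain (0 : Polynomial F) Polynomial.X) (q : ℤ) :
    D.reesMap h2 (D.baseX (Polynomial F) • a) q = (2⁻¹ : F) • D.reesMap h2 a (q + 1) := by
  obtain ⟨p, rfl⟩ := D.toChain_surjective 0 Polynomial.X a
  have h3 : D.baseX (Polynomial F) • D.toChain 0 Polynomial.X p =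
      D.toChain 0 Polynomial.X fun v => X 0 * p v := rfl
  funext v
  rw [h3, reesMap_toChain, reesMap_toChain, Pi.smul_apply, toChain, toChain, map_mul (D.reesHom F), reesHom_X,
    mul_comm _ (D.reesHom F (p v)), ← mul_assoc, Polynomial.intCoeff_mul_X, Polynomial.intCoeff_mul_C,
    ← LinearMap.map_smul_of_tower, ← sub_eq_zero, ← map_sub, toStateModule_eq_zero_iff,
    smul_eq_C_mul, show D.halfDegree v - 1 - q - 1 = D.halfDegree v - 1 - (q + 1) by ring]
  convert Ideal.mul_mem_left _
    ((D.reesHom F (p v)).intCoeff (D.halfDegree v - 1 - (q + 1))) (D.baseX_idempotent v) using 1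
  linear_combination (-X 0 * (D.reesHom F (p v)).intCoeff (D.halfDegree v - 1 - (q + 1))) *
    D.two_mul_C_inv_two h2

theorem reesMap_mem (h2 : (2 : F) ≠ 0) (a : D.Chain (0 : Polynomial F) Polynomial.X) (q : ℤ) :
    D.reesMap h2 a q ∈ D.reducedFiltration (1 : F) 0 q := by
  obtain ⟨p, rfl⟩ := D.toChain_surjective 0 Polynomial.X a
  rw [reesMap_toChain]
  refine ⟨⟨D.toChain 1 0 fun v => (D.reesHom F (p v)).intCoeff (D.halfDegree v - 1 - q), rfl⟩,
    fun v _ => D.toStateModule_mem_qFiltrationAt _ _ fun m hm => ?_⟩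
  rw [D.le_qDegree_iff]
  beta_reduce at hm
  rcases lt_or_ge (D.halfDegree v - 1 - q) 0 with h | h
  · rw [Polynomial.intCoeff_of_neg _ h, mul_zero] at hm
    simp at hm
  · obtain ⟨k, hk⟩ := Int.eq_ofNat_of_zero_le h
    rw [hk, Polynomial.intCoeff_natCast] at hm
    have h3 : m.degree ≤ 1 + k := (le_totalDegree hm).trans <| (totalDegree_mul _ _).trans <|
      add_le_add (totalDegree_X _).le (D.totalDegree_coeff_reesHom_le _ _)
    omega

theorem reesMap_support_finite (h2 : (2 : F) ≠ 0) (a : D.Chain (0 : Polynomial F) Polynomial.X) :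
    (Function.support (D.reesMap h2 a)).Finite := by
  obtain ⟨p, rfl⟩ := D.toChain_surjective 0 Polynomial.X a
  refine (Set.finite_iUnion fun v => Set.finite_Icc
    (D.halfDegree v - 1 - (D.reesHom F (p v)).natDegree) (D.halfDegree v - 1)).subset fun q hq => ?_
  rw [Function.mem_support, reesMap_toChain] at hq
  contrapose! hq
  simp only [Set.mem_iUnion, Set.mem_Icc, not_exists] at hq
  funext v
  have h3 : (D.reesHom F (p v)).intCoeff (D.halfDegree v - 1 - q) = 0 := by
    rw [Polynomial.intCoeff]
    split_ifs
    · refine Polynomial.coeff_eq_zero_of_natDegree_lt ?_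
      have := hq v
      omega
    · rfl
  rw [toChain, h3, mul_zero, map_zero]
  rfl

theorem eq_zero_of_reesMap_eq_zero (h2 : (2 : F) ≠ 0) (a : D.Chain (0 : Polynomial F) Polynomial.X)
    (ha : D.reesMap h2 a = 0) : a = 0 := by
  funext v
  refine D.eq_zero_of_reesState_eq_zero h2 fun l => ?_
  have h3 : D.reesState h2 v (D.halfDegree v - 1 - (D.halfDegree v - 1 - l)) (a v) = 0 :=
    congrFun (congrFun ha (D.halfDegree v - 1 - l)) v
  rwa [sub_sub_cancel] at h3

theorem exists_reesMap_eq_single (h2 : (2 : F) ≠ 0) (q : ℤ) (y : D.Chain (1 : F) 0)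
    (hy : y ∈ D.reducedFiltration (1 : F) 0 q) : ∃ a, D.reesMap h2 a = Pi.single q y := by
  have h3 : ∀ v, ∃ a, ∀ l, D.reesState h2 v l a = if l = D.halfDegree v - 1 - q then y v else 0 := by
    intro v
    have h4 : (X 0 : D.EdgeRing F) • y v = y v := by
      obtain ⟨x, rfl⟩ := hy.1
      obtain ⟨p, rfl⟩ := D.toChain_surjective (1 : F) 0 x
      refine sub_eq_zero.1 ((D.toStateModule_eq_zero_iff 1 0
        (p := X 0 * (X 0 * p v) - X 0 * p v)).2 ?_)
      convert Ideal.mul_mem_left _ (p v) (D.baseX_idempotent v) using 1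
      ring
    refine D.exists_reesState_eq h2 (Submodule.span_mono ?_
      (D.mem_span_of_mem_qFiltrationAt (hy.2 v (Set.mem_univ v)) h4))
    rintro z ⟨m, hm, rfl⟩
    rw [D.le_qDegree_iff] at hm
    exact ⟨m, by push_cast at hm; omega, rfl⟩
  choose a ha using h3
  refine ⟨a, funext fun q' => funext fun v => (ha v _).trans ?_⟩
  rcases eq_or_ne q' q with rfl | hq
  · rw [if_pos rfl, Pi.single_eq_same]
  · rw [if_neg (by omega), Pi.single_eq_of_ne hq]
    rfl

theorem mem_xTorsionExponents_iff (n : ℕ) : n ∈ D.xTorsionExponents F ↔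
    ∀ a, D.d (0 : Polynomial F) Polynomial.X a = 0 →
      (∃ m : ℕ, D.baseX (Polynomial F) ^ m • a ∈ LinearMap.range (D.d 0 Polynomial.X)) →
      D.baseX (Polynomial F) ^ n • a ∈ LinearMap.range (D.d 0 Polynomial.X) := by
  have h1 : ∀ (a : LinearMap.ker (D.d (0 : Polynomial F) Polynomial.X)) (m : ℕ),
      D.baseX (Polynomial F) ^ m • (Submodule.Quotient.mk a : D.LeeHomology F) = 0 ↔
        D.baseX (Polynomial F) ^ m • (a : D.Chain (0 : Polynomial F) Polynomial.X) ∈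
          LinearMap.range (D.d 0 Polynomial.X) := by
    intro a m
    rw [← Submodule.Quotient.mk_smul, Submodule.Quotient.mk_eq_zero]
    rfl
  constructor
  · rintro H a ha ⟨m, hm⟩
    exact (h1 ⟨a, ha⟩ n).1 (H _ ⟨m, (h1 ⟨a, ha⟩ m).2 hm⟩)
  · rintro H a ⟨m, hm⟩
    obtain ⟨a, rfl⟩ := Submodule.Quotient.mk_surjective _ a
    exact (h1 a n).2 (H a a.2 ⟨m, (h1 a m).1 hm⟩)

theorem mem_xTorsionExponents_iff_strictUpTo (h2 : (2 : F) ≠ 0) (n : ℕ) :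
    n ∈ D.xTorsionExponents F ↔ FilteredComplex.StrictUpTo ((D.d (1 : F) 0).restrictScalars F)
      (D.reducedFiltration (1 : F) 0) n := by
  rw [mem_xTorsionExponents_iff]
  exact FilteredComplex.torsion_annihilated_iff_strictUpTo (D.d 0 Polynomial.X)
    (D.baseX (Polynomial F)) (D.reesMap h2) (inv_ne_zero h2) (D.reducedFiltration_antitone 1 0)
    (D.d_d 1 0) (D.eq_zero_of_reesMap_eq_zero h2) (D.reesMap_mem h2) (D.reesMap_support_finite h2)
    (D.exists_reesMap_eq_single h2) (D.reesMap_d h2) (D.reesMap_baseX_smul h2) n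

end KnotDiagram

theorem theorem1 (D : KnotDiagram) (F : Type*) [Field F] (hF : ringChar F ≠ 2) :
    (D.xTorsionExponents F).Nonempty ∧ (D.stableBNLTPages F).Nonempty ∧
      (D.xTorsionOrder F : ℤ) = (D.numPages F : ℤ) - 1 := by
  have h2 : (2 : F) ≠ 0 := Ring.two_ne_zero hF
  have hanti := D.reducedFiltration_antitone (1 : F) 0
  obtain ⟨P, hP⟩ := D.reducedFiltration_eq_bot (F := F)
  obtain ⟨Q, hQ⟩ := D.exists_reducedFiltration_le (F := F)
  have hiff : ∀ n, n + 1 ∈ D.stableBNLTPages F ↔ n ∈ D.xTorsionExponents F := fun n =>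
    (FilteredComplex.add_one_mem_stablePages_iff hanti hP n).trans
      (D.mem_xTorsionExponents_iff_strictUpTo h2 n).symm
  obtain ⟨n, hn⟩ := FilteredComplex.StrictUpTo.exists_of_bounded
    (d := (D.d (1 : F) 0).restrictScalars F) hanti hP hQ
  have hne : (D.xTorsionExponents F).Nonempty :=
    ⟨n, (D.mem_xTorsionExponents_iff_strictUpTo h2 n).2 hn⟩
  have hne' : (D.stableBNLTPages F).Nonempty := hne.imp' (· + 1) fun n hn => (hiff n).2 hn
  refine ⟨hne, hne', ?_⟩
  have hmin : D.numPages F = D.xTorsionOrder F + 1 := by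
    refine le_antisymm (Nat.sInf_le ((hiff _).2 (Nat.sInf_mem hne))) ?_
    have h1 : D.numPages F ∈ D.stableBNLTPages F := Nat.sInf_mem hne'
    obtain ⟨k, hk⟩ : ∃ k, D.numPages F = k + 1 := Nat.exists_eq_succ_of_ne_zero (by
      have := h1.1
      omega)
    rw [hk] at h1 ⊢
    exact Nat.succ_le_succ (Nat.sInf_le ((hiff k).1 h1))
  rw [hmin]
  push_cast
  ring
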